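/- **Three-dimensional fermionic fast Fourier transform on a planar qubit lattice.** Let $M$ be a power of two and $N=M^3$. Label the spin orbitals by $\nu=(\nu_x,\nu_y,\nu_z)\in\{0,\dots,M-1\}^3$ in the canonical order $n(\nu)=\nu_x+\nu_yM+\nu_zM^2$, with fermionic creation and annihilation operators $a_\nu^\dagger,a_\nu$ and number operators $n_\nu=a_\nu^\dagger a_\nu$. The three-dimensional FFFT is the unitary (determined up to a global phase) such that for all $\nu$ $$\mathrm{FFFT}^\dagger a_\nu^\dagger\,\mathrm{FFFT}=\frac1{\sqrt N}\sum_{p\in\{0,\dots,M-1\}^3}e^{-2\pi i\,\nu\cdot p/M}\,a_p^\dagger,\qquad \mathrm{FFFT}^\dagger a_\nu\,\mathrm{FFFT}=\frac1{\sqrt N}\sum_{p}e^{2\pi i\,\nu\cdot p/M}\,a_p .$$ The gate library consists of the fermionic swaps $f_{\rm swap}=1+a_p^\dagger a_q+a_q^\dagger a_p-n_p-n_q$, the gates $F_0$ with $F_0^\dagger=e^{-i(\pi/4)n_q}\,e^{i(\pi/4)n_p}\,e^{i(\pi/4)f_{\rm swap}}\,e^{-i(\pi/2)n_q}$ (in both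 cases $p\ne q$), and the phase gates $e^{-i\varphi n_s}$, $\varphi\in\mathbb R$. There is an absolute constant $K$ such that for every such $M$ and every rectangular lattice of $R\times C=N$ qubits with nearest-neighbour (horizontal and vertical) adjacency, the following holds. The spin orbitals can be stored in the qubits, in canonical order along a Hamiltonian path of the lattice, by the Jordan–Wigner transformation in the order of that path, and there is a circuit of gates from the library that implements the three-dimensional FFFT exactly (up to a global phase), uses at most $KN^2$ gates and has depth at most $KN$. Every two-mode gate of the circuit is applied to two spin orbitals stored in nearest-neighbour qubits of the lattice; every gate acts, as an operator on the register, only on the one or two qubits that store its spin orbitals; and depth is the number of layers, where the gates of one layer act on pairwise disjoint sets of qubits. No qubits other than these $N$ are used. -/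

import Mathlib

open scoped Matrix

namespace FFFT

noncomputable section

/-- Linear operators on the Hilbert space of a register whose qubits are labelled by `Q`, written as
matrices in the computational basis: a basis state is a map `x : Q → Bool`, and `x s = true` means
that qubit `s` is in state `|1⟩` (the spin orbital stored there is occupied). -/
abbrev Operator (Q : Type) : Type := Matrix (Q → Bool) (Q → Bool) ℂ

/-- The planar rectangular lattice with `R` rows and `C` columns: two sites are joined when they are
horizontal or vertical nearest neighbours. -/
abbrev lattice (R C : ℕ) : SimpleGraph (Fin R × Fin C) :=
  (SimpleGraph.pathGraph R).boxProd (SimpleGraph.pathGraph C)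

/-- `π 0, π 1, …, π (N - 1)` is a Hamiltonian path of the graph `G`: since `π` is a bijection every
vertex is visited exactly once, and consecutive vertices are adjacent. -/
def IsHamiltonianPath {Q : Type} (G : SimpleGraph Q) {N : ℕ} (π : Fin N ≃ Q) : Prop :=
  ∀ i j : Fin N, (i : ℕ) + 1 = (j : ℕ) → G.Adj (π i) (π j)

/-- The operator `A` is a gate on the qubits in `S`: it is `B ⊗ 1` for an operator `B` on the qubits
in `S` and the identity on all other qubits. -/
def ActsOnlyOn {Q : Type} [Fintype Q] [DecidableEq Q] (S : Finset Q) (A : Operator Q) : Prop :=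
  ∃ B : Operator S, ∀ x y : Q → Bool,
    A x y = if (∀ t, t ∉ S → x t = y t) then B (fun s => x s) (fun s => y s) else 0

section Fermions

variable {Q : Type} [Fintype Q] [DecidableEq Q] {N : ℕ} (π : Fin N ≃ Q)

/-- The annihilation operator `a_p` of spin orbital `p` under the Jordan-Wigner transformation, where
spin orbital `j` is stored in qubit `π j` and the orbitals are ordered by `j`:
`a_p = Z_{π 0} ⋯ Z_{π (p - 1)} (|0⟩⟨1|)_{π p}`. -/
def annihilate (p : Fin N) : Operator Q :=
  Matrix.of fun y x =>
    if x (π p) = true ∧ y = Function.update x (π p) false then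
      ∏ j : Fin N with j < p, (if x (π j) = true then (-1 : ℂ) else 1)
    else 0

/-- The creation operator `a_p†`. -/
def create (p : Fin N) : Operator Q := (annihilate π p)ᴴ

/-- The number operator `n_p = a_p† a_p`. -/
def number (p : Fin N) : Operator Q := create π p * annihilate π p

/-- The fermionic swap
`f_swap = 1 + a_p† a_q + a_q† a_p - a_p† a_p - a_q† a_q`. -/
def fswap (p q : Fin N) : Operator Q :=
  1 + create π p * annihilate π q + create π q * annihilate π p - number π p - number π q

/-- The adjoint
`F_0† = e^{-i(π/4) n_q} e^{i(π/4) n_p} e^{i(π/4) f_swap} e^{-i(π/2) n_q}` of the two-mode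
fermionic Fourier transform. -/
def F0Adjoint (p q : Fin N) : Operator Q :=
  NormedSpace.exp ((-Complex.I * (Real.pi / 4)) • number π q) *
    NormedSpace.exp ((Complex.I * (Real.pi / 4)) • number π p) *
    NormedSpace.exp ((Complex.I * (Real.pi / 4)) • fswap π p q) *
    NormedSpace.exp ((-Complex.I * (Real.pi / 2)) • number π q)

/-- The two-mode fermionic Fourier transform `F_0`. -/
def F0 (p q : Fin N) : Operator Q := (F0Adjoint π p q)ᴴ

/-- The phase gate `e^{-i φ n_s}`. -/
def phaseGate (φ : ℝ) (s : Fin N) : Operator Q :=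
  NormedSpace.exp ((-Complex.I * (φ : ℂ)) • number π s)

end Fermions

/-- The gate library on `N` spin orbitals: `F_0` gates, fermionic swap gates and phase gates. -/
inductive Gate (N : ℕ) : Type
  | F0 (p q : Fin N) : Gate N
  | fswap (p q : Fin N) : Gate N
  | phase (φ : ℝ) (s : Fin N) : Gate N

namespace Gate

variable {N : ℕ}

/-- The spin orbitals that a gate is applied to. -/
def modes : Gate N → Finset (Fin N)
  | F0 p q => {p, q}
  | fswap p q => {p, q}
  | phase _ s => {s}

/-- The operator that a gate performs on the qubits. -/
def op {Q : Type} [Fintype Q] [DecidableEq Q] (π : Fin N ≃ Q) : Gate N → Operator Q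
  | F0 p q => FFFT.F0 π p q
  | fswap p q => FFFT.fswap π p q
  | phase φ s => FFFT.phaseGate π φ s

/-- The gate can be executed on hardware whose interaction graph is `G`: a two-mode gate is applied to
spin orbitals stored in nearest-neighbour qubits, and the operator acts only on the qubits that store
the spin orbitals of the gate, so that it is a genuine one- or two-qubit gate without a residual
Jordan-Wigner string. -/
def IsNearestNeighbour {Q : Type} [Fintype Q] [DecidableEq Q] (G : SimpleGraph Q) (π : Fin N ≃ Q)
    (g : Gate N) : Prop :=
  (∀ p ∈ g.modes, ∀ q ∈ g.modes, p ≠ q → G.Adj (π p) (π q)) ∧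
    (match g with
      | F0 p q => p ≠ q
      | fswap p q => p ≠ q
      | phase _ _ => True) ∧
    ActsOnlyOn (g.modes.map π.toEmbedding) (g.op π)

end Gate

/-- A circuit is a list of layers, executed from first to last. -/
abbrev Circuit (N : ℕ) : Type := List (List (Gate N))

namespace Circuit

variable {N : ℕ}

/-- The number of gates. -/
def size (c : Circuit N) : ℕ := c.flatten.length

/-- The number of layers. -/
def depth (c : Circuit N) : ℕ := c.length

/-- The circuit can be executed on hardware with interaction graph `G`: every gate is a
nearest-neighbour gate, and the gates of each layer act on pairwise disjoint sets of qubits. -/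
def IsExecutable {Q : Type} [Fintype Q] [DecidableEq Q] (G : SimpleGraph Q) (π : Fin N ≃ Q)
    (c : Circuit N) : Prop :=
  (∀ L ∈ c, ∀ g ∈ L, g.IsNearestNeighbour G π) ∧
    ∀ L ∈ c, L.Pairwise fun g h => Disjoint g.modes h.modes

/-- The operator performed by the circuit: the product of its gates, the first gate rightmost. -/
def op {Q : Type} [Fintype Q] [DecidableEq Q] (π : Fin N ≃ Q) (c : Circuit N) : Operator Q :=
  (c.flatten.map (Gate.op π)).reverse.prod

end Circuit

/-- The canonical ordering `n(ν_x, ν_y, ν_z) = ν_x + ν_y M + ν_z M²` of the spin orbitals. -/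
def orbital {M : ℕ} (ν : Fin 3 → Fin M) : Fin (M ^ 3) := finFunctionFinEquiv ν

/-- The phase `k_ν · r_p = 2π (ν · p) / M`, from `k_ν = 2π ν / Ω^{1/3}`, `r_p = p (Ω / N)^{1/3}` and
`N = M³`. -/
def phase {M : ℕ} (ν p : Fin 3 → Fin M) : ℝ :=
  2 * Real.pi * (∑ i, ((ν i : ℕ) : ℝ) * ((p i : ℕ) : ℝ)) / (M : ℝ)

/-- `U` is the three-dimensional fermionic fast Fourier transform on `N = M³` spin orbitals: `U` is
unitary, and for every `ν`
`U† a_ν† U = N^{-1/2} ∑_p e^{-i k_ν · r_p} a_p†` and `U† a_ν U = N^{-1/2} ∑_p e^{i k_ν · r_p} a_p`. -/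
def IsFFFT3 {Q : Type} [Fintype Q] [DecidableEq Q] {M : ℕ} (π : Fin (M ^ 3) ≃ Q)
    (U : Operator Q) : Prop :=
  U ∈ Matrix.unitaryGroup (Q → Bool) ℂ ∧
    ∀ ν : Fin 3 → Fin M,
      Uᴴ * create π (orbital ν) * U =
          ((Real.sqrt ((M : ℝ) ^ 3))⁻¹ : ℂ) •
            ∑ p : Fin 3 → Fin M,
              Complex.exp (-Complex.I * (phase ν p : ℂ)) • create π (orbital p) ∧
        Uᴴ * annihilate π (orbital ν) * U =
          ((Real.sqrt ((M : ℝ) ^ 3))⁻¹ : ℂ) •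
            ∑ p : Fin 3 → Fin M,
              Complex.exp (Complex.I * (phase ν p : ℂ)) • annihilate π (orbital p)

end

end FFFT

/-!
The circuit does not use the recursive structure of the fast Fourier transform: *every* unitary
transformation `W` of the `N` modes is performed by `O(N ^ 2)` nearest-neighbour gates in depth
`O(N)`.

An operator `U` on the register implements the matrix `W` when `U† a_ν† U = ∑ p, W ν p • a_p†`
(`Implements`), and products of operators implement products of matrices (`Implements.mul`). By the
canonical anticommutation relations, the phase gates implement diagonal matrices
(`implements_phaseGate`). The fermionic swap is `1 - 2 P`, where the idempotent `P` is the number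
operator of the antisymmetric combination of its two modes, so that `F_0` implements the Hadamard
matrix on its two modes (`implements_F0`). Between orbitals that are consecutive in the
Jordan-Wigner order, the strings cancel, and these gates act only on their own qubits
(`actsOnlyOn_F0`). Along a Hamiltonian path, consecutive orbitals are also neighbours on the lattice;
the snake through the rows is such a path (`isHamiltonianPath_snake`).

Two Hadamard gates and phases make up a rotation of two adjacent rows of `W` that produces a zero in
the second one (`exists_rotation_layer`). Eliminating the entry `(i, j)` below the diagonal at time
`(N - 1 - i) + 2 j`, by a rotation of the rows `i - 1` and `i`, lets the rotations of one time step
run in parallel, preserves the zeros produced earlier, and makes `W` upper triangular after `2 N`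
steps of four layers each (`exists_elimination_step`). An upper triangular unitary matrix is a
diagonal matrix of phases, which is one more layer, so the depth is at most `8 N + 1`
(`realizable_of_mem_unitaryGroup`). The gates of a layer have disjoint sets of modes, which bounds
their number by `N` (`Circuit.IsExecutable.size_le`). It remains to apply this to the matrix of the
discrete Fourier transform, which is unitary by the orthogonality of characters
(`dftMatrix_mem_unitaryGroup`).
-/

namespace FFFT

/-! ### Canonical anticommutation relations of the Jordan-Wigner operators -/

section Fermions

variable {Q : Type} {N : ℕ} (π : Fin N ≃ Q)

/-- The sign `(-1)^k` contributed by the Jordan-Wigner string of orbital `p` on the basis state `x`,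
where `k` is the number of occupied orbitals before `p`. -/
noncomputable def jwSign (p : Fin N) (x : Q → Bool) : ℂ :=
  ∏ j : Fin N with j < p, (if x (π j) = true then (-1 : ℂ) else 1)

lemma jwSign_mul_self (p : Fin N) (x : Q → Bool) : jwSign π p x * jwSign π p x = 1 := by
  unfold jwSign
  rw [← Finset.prod_mul_distrib]
  refine Finset.prod_eq_one fun j _ => ?_
  split_ifs <;> norm_num

lemma star_jwSign (p : Fin N) (x : Q → Bool) : star (jwSign π p x) = jwSign π p x := by
  unfold jwSign
  rw [star_prod]
  refine Finset.prod_congr rfl fun j _ => ?_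
  split_ifs <;> simp

variable [DecidableEq Q]

lemma jwSign_update_of_le {p q : Fin N} (h : p ≤ q) (x : Q → Bool) (b : Bool) :
    jwSign π p (Function.update x (π q) b) = jwSign π p x := by
  unfold jwSign
  refine Finset.prod_congr rfl fun j hj => ?_
  have hj' : j < p := by simpa using hj
  rw [Function.update_of_ne]
  intro he
  exact absurd (π.injective he) (ne_of_lt (lt_of_lt_of_le hj' h))

lemma jwSign_update_of_lt {p q : Fin N} (h : q < p) (x : Q → Bool) {b : Bool}
    (hb : x (π q) = !b) :
    jwSign π p (Function.update x (π q) b) = -jwSign π p x := by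
  unfold jwSign
  have hq : q ∈ Finset.univ.filter (fun j : Fin N => j < p) := by simpa using h
  rw [← Finset.mul_prod_erase _ _ hq, ← Finset.mul_prod_erase _ _ hq]
  have : ∀ j ∈ (Finset.univ.filter (fun j : Fin N => j < p)).erase q,
      (if Function.update x (π q) b (π j) = true then (-1 : ℂ) else 1) =
        if x (π j) = true then (-1 : ℂ) else 1 := by
    intro j hj
    rw [Function.update_of_ne]
    intro he
    exact (Finset.ne_of_mem_erase hj) (π.injective he)
  rw [Finset.prod_congr rfl this, Function.update_self, hb]
  cases b <;> simp

variable [Fintype Q]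

lemma annihilate_apply (p : Fin N) (y x : Q → Bool) :
    annihilate π p y x =
      if y (π p) = false ∧ x = Function.update y (π p) true then jwSign π p y else 0 := by
  unfold annihilate
  rw [Matrix.of_apply]
  have hiff : (x (π p) = true ∧ y = Function.update x (π p) false) ↔
      (y (π p) = false ∧ x = Function.update y (π p) true) := by
    constructor
    · rintro ⟨h1, rfl⟩
      refine ⟨by simp, ?_⟩
      rw [Function.update_idem, ← h1, Function.update_eq_self]
    · rintro ⟨h1, rfl⟩
      refine ⟨by simp, ?_⟩
      rw [Function.update_idem, ← h1, Function.update_eq_self]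
  by_cases h : y (π p) = false ∧ x = Function.update y (π p) true
  · rw [if_pos (hiff.2 h), if_pos h, h.2]
    exact jwSign_update_of_le π le_rfl y true
  · rw [if_neg (fun h' => h (hiff.1 h')), if_neg h]

lemma create_apply (p : Fin N) (y x : Q → Bool) :
    create π p y x =
      if y (π p) = true ∧ x = Function.update y (π p) false then jwSign π p y else 0 := by
  unfold create
  rw [Matrix.conjTranspose_apply, annihilate_apply]
  have hiff : (x (π p) = false ∧ y = Function.update x (π p) true) ↔
      (y (π p) = true ∧ x = Function.update y (π p) false) := by
    constructor
    · rintro ⟨h1, rfl⟩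
      refine ⟨by simp, ?_⟩
      rw [Function.update_idem, ← h1, Function.update_eq_self]
    · rintro ⟨h1, rfl⟩
      refine ⟨by simp, ?_⟩
      rw [Function.update_idem, ← h1, Function.update_eq_self]
  by_cases h : y (π p) = true ∧ x = Function.update y (π p) false
  · rw [if_pos (hiff.2 h), if_pos h, star_jwSign, h.2]
    exact jwSign_update_of_le π le_rfl y false
  · rw [if_neg (fun h' => h (hiff.1 h')), if_neg h, star_zero]

lemma annihilate_mulVec (p : Fin N) (f : (Q → Bool) → ℂ) (y : Q → Bool) :
    (annihilate π p *ᵥ f) y =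
      if y (π p) = false then jwSign π p y * f (Function.update y (π p) true) else 0 := by
  simp only [Matrix.mulVec, dotProduct, annihilate_apply]
  by_cases h : y (π p) = false <;> simp [h, ite_mul]

lemma create_mulVec (p : Fin N) (f : (Q → Bool) → ℂ) (y : Q → Bool) :
    (create π p *ᵥ f) y =
      if y (π p) = true then jwSign π p y * f (Function.update y (π p) false) else 0 := by
  simp only [Matrix.mulVec, dotProduct, create_apply]
  by_cases h : y (π p) = true <;> simp [h, ite_mul]

lemma ext_mulVec {A B : Operator Q} (h : ∀ f y, (A *ᵥ f) y = (B *ᵥ f) y) : A = B :=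
  Matrix.mulVec_injective (funext fun f => funext fun y => h f y)

lemma annihilate_mul_annihilate_add_of_lt {p q : Fin N} (h : p < q) :
    annihilate π p * annihilate π q + annihilate π q * annihilate π p = 0 := by
  have hne : π p ≠ π q := fun e => h.ne (π.injective e)
  refine ext_mulVec fun f y => ?_
  simp only [Matrix.add_mulVec, ← Matrix.mulVec_mulVec, Pi.add_apply, annihilate_mulVec,
    Matrix.zero_mulVec, Pi.zero_apply, Function.update_of_ne hne, Function.update_of_ne hne.symm]
  by_cases hp : y (π p) = false
  · by_cases hq : y (π q) = false
    · rw [if_pos hp, if_pos hq, if_pos hq, if_pos hp, jwSign_update_of_le π h.le,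
        jwSign_update_of_lt π h y (b := true) hp, Function.update_comm hne]
      ring
    · simp [hq]
  · simp [hp]

lemma annihilate_mul_self (p : Fin N) : annihilate π p * annihilate π p = 0 := by
  refine ext_mulVec fun f y => ?_
  simp [← Matrix.mulVec_mulVec, annihilate_mulVec]

lemma annihilate_mul_annihilate_add (p q : Fin N) :
    annihilate π p * annihilate π q + annihilate π q * annihilate π p = 0 := by
  rcases lt_trichotomy p q with h | rfl | h
  · exact annihilate_mul_annihilate_add_of_lt π h
  · rw [annihilate_mul_self, add_zero]
  · rw [add_comm]
    exact annihilate_mul_annihilate_add_of_lt π h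

lemma create_mul_create_add (p q : Fin N) :
    create π p * create π q + create π q * create π p = 0 := by
  have := congrArg Matrix.conjTranspose (annihilate_mul_annihilate_add π q p)
  simpa [create, Matrix.conjTranspose_mul, Matrix.conjTranspose_add] using this

lemma create_mul_self (p : Fin N) : create π p * create π p = 0 := by
  have := congrArg Matrix.conjTranspose (annihilate_mul_self π p)
  simpa [create, Matrix.conjTranspose_mul] using this

lemma annihilate_mul_create_add_of_lt {p q : Fin N} (h : p < q) :
    annihilate π p * create π q + create π q * annihilate π p = 0 := by
  have hne : π p ≠ π q := fun e => h.ne (π.injective e)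
  refine ext_mulVec fun f y => ?_
  simp only [Matrix.add_mulVec, ← Matrix.mulVec_mulVec, Pi.add_apply, annihilate_mulVec,
    create_mulVec, Matrix.zero_mulVec, Pi.zero_apply, Function.update_of_ne hne,
    Function.update_of_ne hne.symm]
  by_cases hp : y (π p) = false
  · by_cases hq : y (π q) = true
    · rw [if_pos hp, if_pos hq, if_pos hq, if_pos hp, jwSign_update_of_le π h.le,
        jwSign_update_of_lt π h y (b := true) hp, Function.update_comm hne]
      ring
    · simp [hq]
  · simp [hp]

lemma annihilate_mul_create_add_self (p : Fin N) :
    annihilate π p * create π p + create π p * annihilate π p = 1 := by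
  refine ext_mulVec fun f y => ?_
  simp only [Matrix.add_mulVec, ← Matrix.mulVec_mulVec, Pi.add_apply, annihilate_mulVec,
    create_mulVec, Matrix.one_mulVec, jwSign_update_of_le π le_rfl, Function.update_self,
    Function.update_idem]
  have hs := jwSign_mul_self π p y
  cases hp : y (π p)
  · simp only [if_true, Bool.false_eq_true, if_false, add_zero]
    rw [← hp, Function.update_eq_self, ← mul_assoc, hs, one_mul]
  · simp only [if_true, Bool.true_eq_false, if_false, zero_add]
    rw [← hp, Function.update_eq_self, ← mul_assoc, hs, one_mul]

lemma annihilate_mul_create_add {p q : Fin N} (h : p ≠ q) :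
    annihilate π p * create π q + create π q * annihilate π p = 0 := by
  rcases lt_or_gt_of_ne h with h | h
  · exact annihilate_mul_create_add_of_lt π h
  · have := congrArg Matrix.conjTranspose (annihilate_mul_create_add_of_lt π h)
    simpa [create, Matrix.conjTranspose_mul, Matrix.conjTranspose_add] using this

end Fermions

/-! ### Exponentials of idempotents and the gates -/

section Exponential

variable {n : Type} [Fintype n]

lemma _root_.SemiconjBy.const_smul {V x y : Matrix n n ℂ} (h : SemiconjBy V x y) (t : ℂ) :
    SemiconjBy V (t • x) (t • y) := by
  rw [SemiconjBy, mul_smul_comm, h.eq, smul_mul_assoc]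

lemma _root_.SemiconjBy.of_eq {V x y x' y' : Matrix n n ℂ} (h : SemiconjBy V x y) (hx : x' = x)
    (hy : y' = y) : SemiconjBy V x' y' := by
  rwa [hx, hy]

variable [DecidableEq n]

open scoped Matrix.Norms.Operator in
lemma exp_smul_of_mul_self {P : Matrix n n ℂ} (hP : P * P = P) (z : ℂ) :
    NormedSpace.exp (z • P) = 1 + (Complex.exp z - 1) • P := by
  have h1 : HasSum (fun k : ℕ => ((k.factorial : ℂ)⁻¹ • (z • P) ^ k)) (NormedSpace.exp (z • P)) :=
    NormedSpace.exp_series_hasSum_exp' (𝕂 := ℂ) (z • P)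
  have h2 : HasSum (fun k : ℕ => ((k.factorial : ℂ)⁻¹ • z ^ k)) (Complex.exp z) := by
    have := NormedSpace.exp_series_hasSum_exp' (𝕂 := ℂ) z
    rwa [← Complex.exp_eq_exp_ℂ] at this
  have h3 : HasSum (fun k : ℕ => if k = 0 then (1 - P) else 0) (1 - P) := hasSum_ite_eq 0 (1 - P)
  have h4 := (h2.smul_const P).add h3
  have h5 : (fun k : ℕ => ((k.factorial : ℂ)⁻¹ • (z • P) ^ k)) =
      fun k : ℕ => ((k.factorial : ℂ)⁻¹ • z ^ k) • P + if k = 0 then (1 - P) else 0 := by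
    funext k
    rcases k with _ | k
    · simp
    · have : P ^ (k + 1) = P := IsIdempotentElem.pow_succ_eq k hP
      rw [smul_pow, this, if_neg (Nat.succ_ne_zero k), add_zero, smul_eq_mul, mul_smul]
  rw [h5] at h1
  rw [h1.unique h4, sub_smul, one_smul]
  abel

lemma exp_mem_unitaryGroup {A : Matrix n n ℂ} (h : Aᴴ = -A) :
    NormedSpace.exp A ∈ Matrix.unitaryGroup n ℂ := by
  rw [Matrix.mem_unitaryGroup_iff, Matrix.star_eq_conjTranspose, ← Matrix.exp_conjTranspose, h,
    ← Matrix.exp_add_of_commute _ _ (Commute.neg_right (Commute.refl A)), add_neg_cancel,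
    NormedSpace.exp_zero]

/-- If `P` acts on `c` like the number operator of the mode created by `c`, then conjugation by
`exp (z P)` multiplies `c` by `exp z`. -/
lemma semiconjBy_exp_smul {P c : Matrix n n ℂ} (hP : P * P = P) (hl : P * c = c) (hr : c * P = 0)
    (z : ℂ) : SemiconjBy (NormedSpace.exp (z • P)) c (Complex.exp z • c) := by
  have h1 : (1 + (Complex.exp z - 1) • P) * c = Complex.exp z • c := by
    rw [add_mul, smul_mul_assoc, hl, one_mul, sub_smul, one_smul, add_sub_cancel]
  have h2 : c * (1 + (Complex.exp z - 1) • P) = c := by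
    rw [mul_add, mul_smul_comm, hr, mul_one, smul_zero, add_zero]
  rw [SemiconjBy, exp_smul_of_mul_self hP, h1, smul_mul_assoc, h2]

lemma semiconjBy_exp_of_commute {P c : Matrix n n ℂ} (hP : P * P = P) (h : P * c = c * P)
    (z : ℂ) : SemiconjBy (NormedSpace.exp (z • P)) c c := by
  rw [SemiconjBy, exp_smul_of_mul_self hP, add_mul, mul_add, smul_mul_assoc, h, mul_smul_comm,
    one_mul, mul_one]

end Exponential

section Gates

variable {Q : Type} [Fintype Q] [DecidableEq Q] {N : ℕ} (π : Fin N ≃ Q)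

lemma annihilate_mul_create_eq (p : Fin N) :
    annihilate π p * create π p = 1 - create π p * annihilate π p :=
  eq_sub_of_add_eq (annihilate_mul_create_add_self π p)

lemma number_mul_create_self (p : Fin N) : number π p * create π p = create π p := by
  rw [number, mul_assoc, annihilate_mul_create_eq, mul_sub, mul_one, ← mul_assoc,
    create_mul_self, zero_mul, sub_zero]

lemma create_mul_number_self (p : Fin N) : create π p * number π p = 0 := by
  rw [number, ← mul_assoc, create_mul_self, zero_mul]

lemma number_mul_self (p : Fin N) : number π p * number π p = number π p := by
  conv_lhs => rw [number, ← mul_assoc, ← number, number_mul_create_self]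
  rw [number]

lemma number_mul_create_of_ne {p q : Fin N} (h : p ≠ q) :
    number π p * create π q = create π q * number π p := by
  have h1 := eq_neg_of_add_eq_zero_left (annihilate_mul_create_add π h)
  have h2 := eq_neg_of_add_eq_zero_left (create_mul_create_add π p q)
  rw [number, mul_assoc, h1, mul_neg, ← mul_assoc, h2, neg_mul, neg_neg, mul_assoc]

lemma conjTranspose_number (p : Fin N) : (number π p)ᴴ = number π p := by
  simp [number, create, Matrix.conjTranspose_mul]

/-- The number operator `½ (a_p† - a_q†) (a_p - a_q)` of the antisymmetric combination of the modes
`p` and `q`. -/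
noncomputable def antisymNumber (p q : Fin N) : Operator Q :=
  (2⁻¹ : ℂ) • ((create π p - create π q) * (annihilate π p - annihilate π q))

lemma fswap_eq (p q : Fin N) : fswap π p q = 1 - (2 : ℂ) • antisymNumber π p q := by
  rw [fswap, antisymNumber, smul_smul, number, number]
  norm_num
  noncomm_ring

lemma create_sub_mul_self (p q : Fin N) :
    (create π p - create π q) * (create π p - create π q) = 0 := by
  have e1 := create_mul_self π p
  have e2 := create_mul_self π q
  have e3 := create_mul_create_add π p q
  calc _ = create π p * create π p + create π q * create π q -
    (create π p * create π q + create π q * create π p) := by noncomm_ring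
    _ = 0 := by rw [e1, e2, e3]; simp

lemma antisymNumber_mul_sub {p q : Fin N} (h : p ≠ q) :
    antisymNumber π p q * (create π p - create π q) = create π p - create π q := by
  have h1 : (annihilate π p - annihilate π q) * (create π p - create π q) =
      (2 : ℂ) • 1 - (create π p - create π q) * (annihilate π p - annihilate π q) := by
    have e1 := annihilate_mul_create_add_self π p
    have e2 := annihilate_mul_create_add_self π q
    have e3 := annihilate_mul_create_add π h
    have e4 := annihilate_mul_create_add π h.symm
    have : (annihilate π p - annihilate π q) * (create π p - create π q) +
      (create π p - create π q) * (annihilate π p - annihilate π q) =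
      (annihilate π p * create π p + create π p * annihilate π p) +
      (annihilate π q * create π q + create π q * annihilate π q) -
      (annihilate π p * create π q + create π q * annihilate π p) -
      (annihilate π q * create π p + create π p * annihilate π q) := by noncomm_ring
    rw [e1, e2, e3, e4, sub_zero, sub_zero] at this
    rw [eq_sub_iff_add_eq, this, two_smul]
  rw [antisymNumber, smul_mul_assoc, mul_assoc, h1, mul_sub, ← mul_assoc, create_sub_mul_self,
    zero_mul, sub_zero,
    mul_smul_comm, mul_one, smul_smul]
  norm_num

lemma sub_mul_antisymNumber (p q : Fin N) :
    (create π p - create π q) * antisymNumber π p q = 0 := by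
  rw [antisymNumber, mul_smul_comm, ← mul_assoc, create_sub_mul_self, zero_mul, smul_zero]

lemma antisymNumber_mul_self {p q : Fin N} (h : p ≠ q) :
    antisymNumber π p q * antisymNumber π p q = antisymNumber π p q := by
  conv_lhs =>
    rhs
    rw [antisymNumber]
  rw [mul_smul_comm, ← mul_assoc, antisymNumber_mul_sub π h, antisymNumber]

/-- An operator that anticommutes with both factors commutes with the number operator. -/
lemma antisymNumber_commute {p q : Fin N} {c : Operator Q}
    (h1 : (annihilate π p - annihilate π q) * c + c * (annihilate π p - annihilate π q) = 0)
    (h2 : (create π p - create π q) * c + c * (create π p - create π q) = 0) :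
    antisymNumber π p q * c = c * antisymNumber π p q := by
  rw [antisymNumber, smul_mul_assoc, mul_smul_comm, mul_assoc, eq_neg_of_add_eq_zero_left h1,
    mul_neg, ← mul_assoc, eq_neg_of_add_eq_zero_left h2, neg_mul, neg_neg, mul_assoc]

lemma antisymNumber_mul_add {p q : Fin N} (h : p ≠ q) :
    antisymNumber π p q * (create π p + create π q) =
      (create π p + create π q) * antisymNumber π p q := by
  apply antisymNumber_commute
  · have e1 := annihilate_mul_create_add_self π p
    have e2 := annihilate_mul_create_add_self π q
    have e3 := annihilate_mul_create_add π h
    have e4 := annihilate_mul_create_add π h.symm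
    calc _ = (annihilate π p * create π p + create π p * annihilate π p) -
      (annihilate π q * create π q + create π q * annihilate π q) +
      (annihilate π p * create π q + create π q * annihilate π p) -
      (annihilate π q * create π p + create π p * annihilate π q) := by noncomm_ring
      _ = 0 := by rw [e1, e2, e3, e4]; simp
  · have e1 := create_mul_self π p
    have e2 := create_mul_self π q
    calc _ = create π p * create π p + create π p * create π p -
      (create π q * create π q + create π q * create π q) := by noncomm_ring
      _ = 0 := by rw [e1, e2]; simp

lemma antisymNumber_mul_create {p q r : Fin N} (hp : r ≠ p) (hq : r ≠ q) :
    antisymNumber π p q * create π r = create π r * antisymNumber π p q := by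
  apply antisymNumber_commute
  · have e3 := annihilate_mul_create_add π hp.symm
    have e4 := annihilate_mul_create_add π hq.symm
    calc _ = (annihilate π p * create π r + create π r * annihilate π p) -
      (annihilate π q * create π r + create π r * annihilate π q) := by noncomm_ring
      _ = 0 := by rw [e3, e4]; simp
  · have e1 := create_mul_create_add π p r
    have e2 := create_mul_create_add π q r
    calc _ = (create π p * create π r + create π r * create π p) -
      (create π q * create π r + create π r * create π q) := by noncomm_ring
      _ = 0 := by rw [e1, e2]; simp

/-- Since the fermionic swap is the reflection `1 - 2P` in the antisymmetric mode, its exponential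
is a phase gate on that mode, up to a scalar. -/
lemma exp_smul_fswap {p q : Fin N} (z : ℂ) :
    NormedSpace.exp (z • fswap π p q) =
      Complex.exp z • NormedSpace.exp ((-2 * z) • antisymNumber π p q) := by
  have h : z • fswap π p q = z • (1 : Operator Q) + (-2 * z) • antisymNumber π p q := by
    rw [fswap_eq, smul_sub, smul_smul, sub_eq_add_neg, ← neg_smul]
    congr 2
    ring
  have hc : Commute (z • (1 : Operator Q)) ((-2 * z) • antisymNumber π p q) :=
    ((Commute.one_left _).smul_left _)
  rw [h, Matrix.exp_add_of_commute _ _ hc, exp_smul_of_mul_self (one_mul 1)]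
  have : (1 : Operator Q) + (Complex.exp z - 1) • 1 = Complex.exp z • 1 := by
    rw [sub_smul, one_smul]; abel
  rw [this, smul_mul_assoc, one_mul]

lemma semiconjBy_phase_self (z : ℂ) (s : Fin N) :
    SemiconjBy (NormedSpace.exp (z • number π s)) (create π s) (Complex.exp z • create π s) :=
  semiconjBy_exp_smul (number_mul_self π s) (number_mul_create_self π s)
    (create_mul_number_self π s) z

lemma semiconjBy_phase_of_ne (z : ℂ) {s r : Fin N} (h : s ≠ r) :
    SemiconjBy (NormedSpace.exp (z • number π s)) (create π r) (create π r) :=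
  semiconjBy_exp_of_commute (number_mul_self π s) (number_mul_create_of_ne π h) z

lemma semiconjBy_exp_fswap_of_antisymNumber {p q : Fin N} {x y : Operator Q} (z : ℂ)
    (h : SemiconjBy (NormedSpace.exp ((-2 * z) • antisymNumber π p q)) x y) :
    SemiconjBy (NormedSpace.exp (z • fswap π p q)) x y := by
  rw [exp_smul_fswap, SemiconjBy, smul_mul_assoc, h.eq, mul_smul_comm]

lemma semiconjBy_exp_fswap_create {p q : Fin N} (h : p ≠ q) :
    SemiconjBy (NormedSpace.exp ((Complex.I * (Real.pi / 4)) • fswap π p q)) (create π p)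
        (((1 - Complex.I) / 2) • create π p + ((1 + Complex.I) / 2) • create π q) ∧
      SemiconjBy (NormedSpace.exp ((Complex.I * (Real.pi / 4)) • fswap π p q)) (create π q)
        (((1 + Complex.I) / 2) • create π p + ((1 - Complex.I) / 2) • create π q) := by
  have hz : Complex.exp (-2 * (Complex.I * (Real.pi / 4))) = -Complex.I := by
    rw [show -2 * (Complex.I * (Real.pi / 4)) = -Real.pi / 2 * Complex.I by ring,
      Complex.exp_neg_pi_div_two_mul_I]
  have h1 := semiconjBy_exp_fswap_of_antisymNumber π (Complex.I * (Real.pi / 4))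
    (semiconjBy_exp_smul (antisymNumber_mul_self π h) (antisymNumber_mul_sub π h)
      (sub_mul_antisymNumber π p q) _)
  have h2 := semiconjBy_exp_fswap_of_antisymNumber π (Complex.I * (Real.pi / 4))
    (semiconjBy_exp_of_commute (antisymNumber_mul_self π h) (antisymNumber_mul_add π h) _)
  rw [hz] at h1
  constructor
  · exact ((h2.const_smul 2⁻¹).add_right (h1.const_smul 2⁻¹)).of_eq (by module) (by module)
  · exact ((h2.const_smul 2⁻¹).sub_right (h1.const_smul 2⁻¹)).of_eq (by module) (by module)

/-- `F_0` acts on the creation operators of its two modes as the Hadamard matrix. -/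
lemma semiconjBy_F0Adjoint {p q : Fin N} (h : p ≠ q) :
    SemiconjBy (F0Adjoint π p q) (create π p)
        (((Real.sqrt 2 : ℝ) : ℂ)⁻¹ • (create π p + create π q)) ∧
      SemiconjBy (F0Adjoint π p q) (create π q)
        (((Real.sqrt 2 : ℝ) : ℂ)⁻¹ • (create π p - create π q)) := by
  set w : ℂ := ((Real.sqrt 2 : ℝ) : ℂ)⁻¹ with hw
  have hwv : ((Real.sqrt 2 / 2 : ℝ) : ℂ) = w := by
    rw [hw, Complex.ofReal_div]
    have h2 : ((Real.sqrt 2 : ℝ) : ℂ) * ((Real.sqrt 2 : ℝ) : ℂ) = 2 := by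
      rw [← Complex.ofReal_mul, Real.mul_self_sqrt (by norm_num)]; norm_num
    have h0 : ((Real.sqrt 2 : ℝ) : ℂ) ≠ 0 := by
      intro h0; rw [h0] at h2; norm_num at h2
    field_simp
    push_cast
    linear_combination h2
  have hplus : Complex.exp (Complex.I * (Real.pi / 4)) = w * (1 + Complex.I) := by
    rw [mul_comm, Complex.exp_mul_I,
      show (Real.pi / 4 : ℂ) = ((Real.pi / 4 : ℝ) : ℂ) by push_cast; rfl,
      ← Complex.ofReal_cos, ← Complex.ofReal_sin, Real.cos_pi_div_four, Real.sin_pi_div_four, hwv]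
    ring
  have hminus : Complex.exp (-Complex.I * (Real.pi / 4)) = w * (1 - Complex.I) := by
    rw [show -Complex.I * (Real.pi / 4 : ℂ) = ((-(Real.pi / 4) : ℝ) : ℂ) * Complex.I by
        push_cast; ring, Complex.exp_mul_I,
      ← Complex.ofReal_cos, ← Complex.ofReal_sin, Real.cos_neg, Real.sin_neg,
      Real.cos_pi_div_four, Real.sin_pi_div_four, Complex.ofReal_neg, hwv]
    ring
  have hhalf : Complex.exp (-Complex.I * (Real.pi / 2)) = -Complex.I := by
    rw [show -Complex.I * (Real.pi / 2) = -Real.pi / 2 * Complex.I by ring,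
      Complex.exp_neg_pi_div_two_mul_I]
  obtain ⟨hfp, hfq⟩ := semiconjBy_exp_fswap_create π h
  have a1 := semiconjBy_phase_of_ne π (-Complex.I * (Real.pi / 2)) h.symm
  have a2 := semiconjBy_phase_self π (-Complex.I * (Real.pi / 2)) q
  have b1 := semiconjBy_phase_self π (Complex.I * (Real.pi / 4)) p
  have b2 := semiconjBy_phase_of_ne π (Complex.I * (Real.pi / 4)) h
  have c1 := semiconjBy_phase_of_ne π (-Complex.I * (Real.pi / 4)) h.symm
  have c2 := semiconjBy_phase_self π (-Complex.I * (Real.pi / 4)) q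
  rw [hplus] at b1
  rw [hminus] at c2
  rw [hhalf] at a2
  have hI := Complex.I_mul_I
  unfold F0Adjoint
  -- The four exponentials enter only through their action on the two creation operators.
  generalize NormedSpace.exp ((-Complex.I * (Real.pi / 4)) • number π q) = E₁ at *
  generalize NormedSpace.exp ((Complex.I * (Real.pi / 4)) • number π p) = E₂ at *
  generalize NormedSpace.exp ((Complex.I * (Real.pi / 4)) • fswap π p q) = E₃ at *
  generalize NormedSpace.exp ((-Complex.I * (Real.pi / 2)) • number π q) = E₄ at *
  have key : ∀ α β : ℂ, SemiconjBy (E₁ * E₂) (α • create π p + β • create π q)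
      ((α * (w * (1 + Complex.I))) • create π p + (β * (w * (1 - Complex.I))) • create π q) := by
    intro α β
    have b := (b1.const_smul α).add_right (b2.const_smul β)
    rw [smul_smul] at b
    have c := (c1.const_smul (α * (w * (1 + Complex.I)))).add_right (c2.const_smul β)
    rw [smul_smul β] at c
    exact c.mul_left b
  constructor
  · refine (((key _ _).mul_left hfp).mul_left a1).of_eq rfl ?_
    rw [smul_add]
    congr 2 <;> linear_combination (w / 2) * hI
  · refine ((((key _ _).mul_left hfq).const_smul _).mul_left a2).of_eq rfl ?_
    rw [smul_sub, sub_eq_add_neg, ← neg_smul, smul_add, smul_smul, smul_smul]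
    congr 2
    · linear_combination (w + w * Complex.I / 2) * hI
    · linear_combination (-w + w * Complex.I / 2) * hI

lemma semiconjBy_F0Adjoint_of_ne {p q r : Fin N} (hp : r ≠ p) (hq : r ≠ q) (h : p ≠ q) :
    SemiconjBy (F0Adjoint π p q) (create π r) (create π r) := by
  refine ((SemiconjBy.mul_left (semiconjBy_phase_of_ne π _ hq.symm)
    (semiconjBy_phase_of_ne π _ hp.symm)).mul_left ?_).mul_left
    (semiconjBy_phase_of_ne π _ hq.symm)
  exact semiconjBy_exp_fswap_of_antisymNumber π _ (semiconjBy_exp_of_commute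
    (antisymNumber_mul_self π h) (antisymNumber_mul_create π hp hq) _)

lemma exp_I_smul_mem_unitaryGroup {A : Operator Q} (hA : Aᴴ = A) (x : ℝ) :
    NormedSpace.exp ((Complex.I * (x : ℂ)) • A) ∈ Matrix.unitaryGroup (Q → Bool) ℂ := by
  apply exp_mem_unitaryGroup
  rw [Matrix.conjTranspose_smul, hA, ← neg_smul]
  simp

lemma conjTranspose_fswap (p q : Fin N) : (fswap π p q)ᴴ = fswap π p q := by
  simp only [fswap, create, Matrix.conjTranspose_sub, Matrix.conjTranspose_add,
    Matrix.conjTranspose_mul, Matrix.conjTranspose_one, Matrix.conjTranspose_conjTranspose,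
    conjTranspose_number]
  abel

lemma F0Adjoint_mem_unitaryGroup (p q : Fin N) :
    F0Adjoint π p q ∈ Matrix.unitaryGroup (Q → Bool) ℂ := by
  have hn := exp_I_smul_mem_unitaryGroup (conjTranspose_number π q)
  have h1 := hn (-(Real.pi / 4))
  have h2 := exp_I_smul_mem_unitaryGroup (conjTranspose_number π p) (Real.pi / 4)
  have h3 := exp_I_smul_mem_unitaryGroup (conjTranspose_fswap π p q) (Real.pi / 4)
  have h4 := hn (-(Real.pi / 2))
  push_cast at h1 h2 h3 h4
  rw [mul_neg, ← neg_mul] at h1 h4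
  exact mul_mem (mul_mem (mul_mem h1 h2) h3) h4

/-! ### Single-particle matrices of operators -/

/-- The unitary operator `U` transforms the creation operators linearly, with the matrix `W`:
`U† a_ν† U = ∑ p, W ν p • a_p†` for all `ν`. -/
def Implements (U : Operator Q) (W : Matrix (Fin N) (Fin N) ℂ) : Prop :=
  U ∈ Matrix.unitaryGroup (Q → Bool) ℂ ∧
    ∀ ν, SemiconjBy Uᴴ (create π ν) (∑ p, W ν p • create π p)

lemma Implements.one : Implements π 1 1 := by
  refine ⟨one_mem _, fun ν => ?_⟩
  simp [Matrix.one_apply]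

variable {π} in
lemma Implements.mul {U₁ U₂ : Operator Q} {W₁ W₂ : Matrix (Fin N) (Fin N) ℂ}
    (h₂ : Implements π U₂ W₂) (h₁ : Implements π U₁ W₁) : Implements π (U₂ * U₁) (W₂ * W₁) := by
  refine ⟨mul_mem h₂.1 h₁.1, fun ν => ?_⟩
  rw [Matrix.conjTranspose_mul]
  refine SemiconjBy.mul_left ?_ (h₂.2 ν)
  have hs : ∀ s : Finset (Fin N), SemiconjBy U₁ᴴ (∑ p ∈ s, W₂ ν p • create π p)
      (∑ p ∈ s, W₂ ν p • ∑ q, W₁ p q • create π q) := by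
    intro s
    rw [SemiconjBy, Finset.mul_sum, Finset.sum_mul]
    exact Finset.sum_congr rfl fun p _ => ((h₁.2 p).const_smul _).eq
  refine (hs Finset.univ).of_eq rfl ?_
  simp only [Matrix.mul_apply, Finset.sum_smul, Finset.smul_sum, smul_smul]
  exact Finset.sum_comm

/-- The single-particle matrix of `F_0`: the Hadamard matrix on the modes `p` and `q`, and the
identity on all others. -/
noncomputable def hadamard (p q : Fin N) : Matrix (Fin N) (Fin N) ℂ :=
  fun r => if r = p then ((Real.sqrt 2 : ℝ) : ℂ)⁻¹ • (Pi.single p 1 + Pi.single q 1)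
    else if r = q then ((Real.sqrt 2 : ℝ) : ℂ)⁻¹ • (Pi.single p 1 - Pi.single q 1)
    else Pi.single r 1

lemma implements_F0 {p q : Fin N} (h : p ≠ q) : Implements π (F0 π p q) (hadamard p q) := by
  refine ⟨Unitary.star_mem (F0Adjoint_mem_unitaryGroup π p q), fun ν => ?_⟩
  rw [F0, Matrix.conjTranspose_conjTranspose]
  by_cases hp : ν = p
  · subst hp
    refine (semiconjBy_F0Adjoint π h).1.of_eq rfl ?_
    simp [hadamard, Pi.single_apply, mul_add, add_smul, Finset.sum_add_distrib]
  · by_cases hq : ν = q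
    · subst hq
      refine (semiconjBy_F0Adjoint π h).2.of_eq rfl ?_
      simp [hadamard, hp, Pi.single_apply, mul_sub, sub_smul, smul_sub, Finset.sum_sub_distrib]
    · refine (semiconjBy_F0Adjoint_of_ne π hp hq h).of_eq rfl ?_
      simp [hadamard, hp, hq, Pi.single_apply]

lemma conjTranspose_phaseGate (φ : ℝ) (s : Fin N) :
    (phaseGate π φ s)ᴴ = NormedSpace.exp ((Complex.I * (φ : ℂ)) • number π s) := by
  rw [phaseGate, ← Matrix.exp_conjTranspose, Matrix.conjTranspose_smul, conjTranspose_number]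
  simp

lemma implements_phaseGate (φ : ℝ) (s : Fin N) :
    Implements π (phaseGate π φ s)
      (Matrix.diagonal (Function.update 1 s (Complex.exp (Complex.I * φ)))) := by
  constructor
  · have := exp_I_smul_mem_unitaryGroup (conjTranspose_number π s) (-φ)
    rwa [Complex.ofReal_neg, mul_neg, ← neg_mul] at this
  · intro ν
    rw [conjTranspose_phaseGate]
    by_cases h : s = ν
    · subst h
      refine (semiconjBy_phase_self π _ s).of_eq rfl ?_
      simp [Matrix.diagonal_apply]
    · refine (semiconjBy_phase_of_ne π _ h).of_eq rfl ?_
      simp [Matrix.diagonal_apply, Function.update_of_ne (Ne.symm h)]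

end Gates

/-! ### Locality of the gates -/

section Locality

variable {Q : Type} [Fintype Q] [DecidableEq Q] {S : Finset Q} {A B : Operator Q}

/-- An operator acts only on `S` if its entries vanish between basis states that differ off `S`, and
otherwise depend only on the restrictions of the basis states to `S`. -/
lemma actsOnlyOn_of_apply
    (h0 : ∀ x y : Q → Bool, ∀ t ∉ S, x t ≠ y t → A x y = 0)
    (h1 : ∀ x y x' y' : Q → Bool, (∀ t ∉ S, x t = y t) → (∀ t ∉ S, x' t = y' t) →
      (∀ t ∈ S, x t = x' t) → (∀ t ∈ S, y t = y' t) → A x y = A x' y') :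
    ActsOnlyOn S A := by
  classical
  let ext : (S → Bool) → Q → Bool := fun s t => if h : t ∈ S then s ⟨t, h⟩ else false
  refine ⟨fun s s' => A (ext s) (ext s'), fun x y => ?_⟩
  split_ifs with h
  · exact h1 _ _ _ _ h (fun t ht => by simp [ext, ht]) (fun t ht => by simp [ext, ht])
      (fun t ht => by simp [ext, ht])
  · push Not at h
    obtain ⟨t, ht, hne⟩ := h
    exact h0 x y t ht hne

lemma ActsOnlyOn.add (hA : ActsOnlyOn S A) (hB : ActsOnlyOn S B) : ActsOnlyOn S (A + B) := by
  obtain ⟨a, ha⟩ := hA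
  obtain ⟨b, hb⟩ := hB
  refine ⟨a + b, fun x y => ?_⟩
  rw [Matrix.add_apply, ha, hb]
  split_ifs <;> simp

lemma ActsOnlyOn.smul (c : ℂ) (hA : ActsOnlyOn S A) : ActsOnlyOn S (c • A) := by
  obtain ⟨a, ha⟩ := hA
  refine ⟨c • a, fun x y => ?_⟩
  rw [Matrix.smul_apply, ha]
  split_ifs <;> simp

lemma ActsOnlyOn.sub (hA : ActsOnlyOn S A) (hB : ActsOnlyOn S B) : ActsOnlyOn S (A - B) := by
  rw [sub_eq_add_neg, ← neg_one_smul ℂ B]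
  exact hA.add (hB.smul _)

lemma ActsOnlyOn.conjTranspose (hA : ActsOnlyOn S A) : ActsOnlyOn S Aᴴ := by
  obtain ⟨a, ha⟩ := hA
  refine ⟨aᴴ, fun x y => ?_⟩
  rw [Matrix.conjTranspose_apply, ha]
  by_cases h : ∀ t, t ∉ S → x t = y t
  · rw [if_pos h, if_pos fun t ht => (h t ht).symm, Matrix.conjTranspose_apply]
  · rw [if_neg h, if_neg fun h' => h fun t ht => (h' t ht).symm, star_zero]

lemma actsOnlyOn_one : ActsOnlyOn S (1 : Operator Q) := by
  refine actsOnlyOn_of_apply (fun x y t _ h => ?_) (fun x y x' y' h h' hx hy => ?_)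
  · exact Matrix.one_apply_ne fun e => h (congrFun e t)
  · have : x = y ↔ x' = y' := by
      simp only [funext_iff]
      refine forall_congr' fun t => ?_
      by_cases ht : t ∈ S
      · rw [hx t ht, hy t ht]
      · simp [h t ht, h' t ht]
    simp only [Matrix.one_apply, this]

lemma ActsOnlyOn.mul (hA : ActsOnlyOn S A) (hB : ActsOnlyOn S B) : ActsOnlyOn S (A * B) := by
  classical
  obtain ⟨a, ha⟩ := hA
  obtain ⟨b, hb⟩ := hB
  refine ⟨a * b, fun x y => ?_⟩
  rw [Matrix.mul_apply]
  split_ifs with h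
  · rw [Matrix.mul_apply]
    symm
    refine Finset.sum_of_injOn (fun w t => if ht : t ∈ S then w ⟨t, ht⟩ else x t) ?_ (by simp)
      ?_ ?_
    · intro w _ w' _ e
      funext t
      simpa using congrFun e t
    · intro z _ hz
      rw [ha, if_neg, zero_mul]
      intro hxz
      refine hz ⟨fun t => z t, by simp, ?_⟩
      funext t
      by_cases ht : t ∈ S <;> simp [ht, hxz]
    · intro w _
      rw [ha, hb, if_pos (by intro t ht; simp [ht]), if_pos (by intro t ht; simp [ht, h])]
      simp
  · push Not at h
    obtain ⟨t, ht, hne⟩ := h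
    refine Finset.sum_eq_zero fun z _ => ?_
    by_cases hz : x t = z t
    · rw [hb, if_neg fun h' => hne (hz.trans (h' t ht)), mul_zero]
    · rw [ha, if_neg fun h' => hz (h' t ht), zero_mul]

lemma ActsOnlyOn.exp_smul {P : Operator Q} (hP : P * P = P) (h : ActsOnlyOn S P) (z : ℂ) :
    ActsOnlyOn S (NormedSpace.exp (z • P)) := by
  rw [exp_smul_of_mul_self hP]
  exact actsOnlyOn_one.add (h.smul _)

variable {N : ℕ} (π : Fin N ≃ Q)

lemma number_apply (p : Fin N) (x y : Q → Bool) :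
    number π p x y = if x (π p) = true ∧ x = y then 1 else 0 := by
  rw [number, Matrix.mul_apply]
  simp only [create_apply, annihilate_apply]
  rw [Finset.sum_eq_single (Function.update x (π p) false)]
  · by_cases hx : x (π p) = true
    · have : Function.update x (π p) true = x := by rw [← hx, Function.update_eq_self]
      simp [hx, this, jwSign_update_of_le, eq_comm, jwSign_mul_self]
    · simp [hx]
  · intro z _ hz
    simp [hz]
  · simp

/-- For consecutive orbitals the Jordan-Wigner strings cancel, so that hopping between them has
no sign. -/
lemma create_mul_annihilate_apply {p q : Fin N} (h : (p : ℕ) + 1 = q) (x y : Q → Bool) :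
    (create π p * annihilate π q) x y =
      if x (π p) = true ∧ x (π q) = false ∧
        y = Function.update (Function.update x (π p) false) (π q) true then 1 else 0 := by
  have hlt : p < q := by rw [Fin.lt_def]; omega
  have hne : π p ≠ π q := fun e => hlt.ne (π.injective e)
  rw [Matrix.mul_apply]
  simp only [create_apply, annihilate_apply]
  rw [Finset.sum_eq_single (Function.update x (π p) false)]
  · by_cases hx : x (π p) = true
    · have hs : jwSign π q (Function.update x (π p) false) = jwSign π p x := by
        rw [← jwSign_update_of_le π (le_refl p) x false]
        unfold jwSign
        have : Finset.univ.filter (fun j : Fin N => j < q) =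
            insert p (Finset.univ.filter (fun j : Fin N => j < p)) := by
          ext j
          simp only [Finset.mem_filter, Finset.mem_univ, true_and, Finset.mem_insert, Fin.lt_def,
            Fin.ext_iff]
          omega
        rw [this, Finset.prod_insert (by simp)]
        simp
      by_cases hq : x (π q) = false
      · simp [hx, hq, hs, hne.symm, jwSign_mul_self]
      · simp [hq, hne.symm]
    · simp [hx]
  · intro z _ hz
    simp [hz]
  · simp

lemma actsOnlyOn_number {p : Fin N} (hp : π p ∈ S) : ActsOnlyOn S (number π p) := by
  refine actsOnlyOn_of_apply (fun x y t _ h => ?_) (fun x y x' y' h h' hx hy => ?_)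
  · rw [number_apply, if_neg fun e => h (congrFun e.2 t)]
  · have : x = y ↔ x' = y' := by
      simp only [funext_iff]
      refine forall_congr' fun t => ?_
      by_cases ht : t ∈ S
      · rw [hx t ht, hy t ht]
      · simp [h t ht, h' t ht]
    simp only [number_apply, this, hx _ hp]

lemma actsOnlyOn_create_mul_annihilate {p q : Fin N} (h : (p : ℕ) + 1 = q) (hp : π p ∈ S)
    (hq : π q ∈ S) : ActsOnlyOn S (create π p * annihilate π q) := by
  refine actsOnlyOn_of_apply (fun x y t ht h => ?_) (fun x y x' y' h h' hx hy => ?_)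
  · rw [create_mul_annihilate_apply π ‹_›, if_neg]
    rintro ⟨-, -, rfl⟩
    have h1 : t ≠ π p := fun e => ht (e ▸ hp)
    have h2 : t ≠ π q := fun e => ht (e ▸ hq)
    exact h (by simp [h1, h2])
  · have : y = Function.update (Function.update x (π p) false) (π q) true ↔
        y' = Function.update (Function.update x' (π p) false) (π q) true := by
      simp only [funext_iff]
      refine forall_congr' fun t => ?_
      by_cases ht : t ∈ S
      · simp [Function.update_apply, hx t ht, hy t ht]
      · have h1 : t ≠ π p := fun e => ht (e ▸ hp)
        have h2 : t ≠ π q := fun e => ht (e ▸ hq)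
        simp [h1, h2, h t ht, h' t ht]
    simp only [create_mul_annihilate_apply π ‹_›, this, hx _ hp, hx _ hq]

lemma actsOnlyOn_antisymNumber {p q : Fin N} (h : (p : ℕ) + 1 = q) (hp : π p ∈ S)
    (hq : π q ∈ S) : ActsOnlyOn S (antisymNumber π p q) := by
  have h1 := actsOnlyOn_create_mul_annihilate π h hp hq
  have h2 := h1.conjTranspose
  rw [Matrix.conjTranspose_mul, create, Matrix.conjTranspose_conjTranspose] at h2
  have : antisymNumber π p q = (2⁻¹ : ℂ) • (number π p + number π q -
      create π p * annihilate π q - create π q * annihilate π p) := by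
    rw [antisymNumber, number, number]
    noncomm_ring
  rw [this]
  exact ((((actsOnlyOn_number π hp).add (actsOnlyOn_number π hq)).sub h1).sub h2).smul _

lemma actsOnlyOn_phaseGate (φ : ℝ) {s : Fin N} (hs : π s ∈ S) :
    ActsOnlyOn S (phaseGate π φ s) :=
  (actsOnlyOn_number π hs).exp_smul (number_mul_self π s) _

lemma actsOnlyOn_F0 {p q : Fin N} (h : (p : ℕ) + 1 = q) (hp : π p ∈ S) (hq : π q ∈ S) :
    ActsOnlyOn S (F0 π p q) := by
  have hne : p ≠ q := fun e => by rw [e] at h; omega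
  refine ActsOnlyOn.conjTranspose ?_
  refine ActsOnlyOn.mul (.mul (.mul ?_ ?_) ?_) ?_
  · exact (actsOnlyOn_number π hq).exp_smul (number_mul_self π q) _
  · exact (actsOnlyOn_number π hp).exp_smul (number_mul_self π p) _
  · rw [exp_smul_fswap]
    exact ((actsOnlyOn_antisymNumber π h hp hq).exp_smul (antisymNumber_mul_self π hne) _).smul _
  · exact (actsOnlyOn_number π hq).exp_smul (number_mul_self π q) _

end Locality

/-! ### Circuits and their layers -/

section Circuits

variable {Q : Type} [Fintype Q] [DecidableEq Q] {N : ℕ}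

/-- The matrix `W` is the single-particle matrix of a circuit of depth at most `d` that can be
executed on `G`. -/
def Realizable (G : SimpleGraph Q) (π : Fin N ≃ Q) (d : ℕ) (W : Matrix (Fin N) (Fin N) ℂ) : Prop :=
  ∃ c : Circuit N, c.IsExecutable G π ∧ c.depth ≤ d ∧ Implements π (c.op π) W

variable {G : SimpleGraph Q} {π : Fin N ≃ Q}

lemma Realizable.mul {d₁ d₂ : ℕ} {W₁ W₂ : Matrix (Fin N) (Fin N) ℂ} (h₂ : Realizable G π d₂ W₂)
    (h₁ : Realizable G π d₁ W₁) : Realizable G π (d₂ + d₁) (W₂ * W₁) := by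
  obtain ⟨c₂, e₂, l₂, i₂⟩ := h₂
  obtain ⟨c₁, e₁, l₁, i₁⟩ := h₁
  refine ⟨c₁ ++ c₂, ⟨?_, ?_⟩, ?_, ?_⟩
  · intro L hL
    rcases List.mem_append.1 hL with h | h
    exacts [e₁.1 L h, e₂.1 L h]
  · intro L hL
    rcases List.mem_append.1 hL with h | h
    exacts [e₁.2 L h, e₂.2 L h]
  · simp only [Circuit.depth, List.length_append] at *
    omega
  · have : Circuit.op π (c₁ ++ c₂) = c₂.op π * c₁.op π := by simp [Circuit.op]
    rw [this]
    exact i₂.mul i₁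

/-- A layer of pairwise disjoint nearest-neighbour gates realizes the product of the single-particle
matrices of its gates. -/
lemma realizable_layer {ι : Type} (l : List ι) (gate : ι → Gate N)
    (mat : ι → Matrix (Fin N) (Fin N) ℂ)
    (hnn : ∀ i ∈ l, (gate i).IsNearestNeighbour G π)
    (himp : ∀ i ∈ l, Implements π ((gate i).op π) (mat i))
    (hd : l.Pairwise fun i j => Disjoint (gate i).modes (gate j).modes) :
    Realizable G π 1 (l.map mat).reverse.prod := by
  refine ⟨[l.map gate], ⟨?_, ?_⟩, by simp [Circuit.depth], ?_⟩
  · simpa using hnn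
  · simpa [List.pairwise_map] using hd
  · have h : Circuit.op π [l.map gate] = (l.map fun i => (gate i).op π).reverse.prod := by
      simp [Circuit.op, Function.comp_def]
    rw [h]
    clear h hnn hd
    induction l with
    | nil => simpa using Implements.one π
    | cons a l ih =>
      simp only [List.map_cons, List.reverse_cons, List.prod_append, List.prod_singleton]
      exact (ih fun i hi => himp i (List.mem_cons_of_mem _ hi)).mul (himp a List.mem_cons_self)

/-- A circuit whose layers consist of gates with disjoint modes has at most `N` gates per layer. -/
lemma Circuit.IsExecutable.size_le {c : Circuit N} (h : c.IsExecutable G π) :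
    c.size ≤ N * c.depth := by
  -- Choosing one mode of each gate maps the gates of a layer injectively to the modes.
  let rep : Gate N → Fin N := fun g => match g with
    | .F0 p _ => p
    | .fswap p _ => p
    | .phase _ s => s
  have hrep : ∀ g : Gate N, rep g ∈ g.modes := by
    rintro (_ | _ | _) <;> simp [rep, Gate.modes]
  have hL : ∀ L ∈ c, L.length ≤ N := by
    intro L hL
    have hn : (L.map rep).Nodup := by
      rw [List.Nodup, List.pairwise_map]
      refine (h.2 L hL).imp fun {a b} hab e => ?_
      exact Finset.disjoint_left.1 hab (hrep a) (e ▸ hrep b)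
    simpa using hn.length_le_card
  rw [Circuit.size, Circuit.depth, List.length_flatten, mul_comm]
  have := List.sum_le_card_nsmul (c.map List.length) N (by simpa using hL)
  simpa using this

end Circuits

/-! ### Layers of Hadamard and phase gates -/

section Layers

variable {N : ℕ}

lemma hadamard_mul_fst (p q : Fin N) (A : Matrix (Fin N) (Fin N) ℂ) :
    (hadamard p q * A) p = ((Real.sqrt 2 : ℝ) : ℂ)⁻¹ • (A p + A q) := by
  rw [Matrix.mul_apply_eq_vecMul]
  simp [hadamard, Matrix.smul_vecMul, Matrix.add_vecMul, Matrix.row_def]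

lemma hadamard_mul_snd {p q : Fin N} (h : p ≠ q) (A : Matrix (Fin N) (Fin N) ℂ) :
    (hadamard p q * A) q = ((Real.sqrt 2 : ℝ) : ℂ)⁻¹ • (A p - A q) := by
  rw [Matrix.mul_apply_eq_vecMul]
  simp [hadamard, h.symm, Matrix.smul_vecMul, Matrix.sub_vecMul, Matrix.row_def]

lemma hadamard_mul_of_ne {p q r : Fin N} (hp : r ≠ p) (hq : r ≠ q)
    (A : Matrix (Fin N) (Fin N) ℂ) : (hadamard p q * A) r = A r := by
  rw [Matrix.mul_apply_eq_vecMul]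
  simp [hadamard, hp, hq, Matrix.row_def]

lemma inv_sqrt_two_mul_self : ((Real.sqrt 2 : ℝ) : ℂ)⁻¹ * ((Real.sqrt 2 : ℝ) : ℂ)⁻¹ = 2⁻¹ := by
  rw [← mul_inv, ← Complex.ofReal_mul, Real.mul_self_sqrt (by norm_num)]
  norm_num

lemma hadamard_mem_unitaryGroup {p q : Fin N} (h : p ≠ q) :
    hadamard p q ∈ Matrix.unitaryGroup (Fin N) ℂ := by
  have hs : star (hadamard p q) = hadamard p q := by
    ext r c
    rw [Matrix.star_apply]
    simp only [hadamard]
    by_cases hrp : r = p <;> by_cases hrq : r = q <;> by_cases hcp : c = p <;>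
      by_cases hcq : c = q <;> by_cases hrc : r = c <;>
      simp_all [eq_comm]
  rw [Matrix.mem_unitaryGroup_iff, hs]
  refine funext fun r => ?_
  have key : ((Real.sqrt 2 : ℝ) : ℂ)⁻¹ * ((Real.sqrt 2 : ℝ) : ℂ)⁻¹ = 2⁻¹ := inv_sqrt_two_mul_self
  rw [← mul_one (hadamard p q * hadamard p q), mul_assoc]
  by_cases hp : r = p
  · subst hp
    rw [hadamard_mul_fst, hadamard_mul_fst, hadamard_mul_snd h, ← smul_add, smul_smul, key]
    module
  · by_cases hq : r = q
    · subst hq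
      rw [hadamard_mul_snd h, hadamard_mul_fst, hadamard_mul_snd h, ← smul_sub, smul_smul, key]
      module
    · rw [hadamard_mul_of_ne hp hq, hadamard_mul_of_ne hp hq]

/-- The single-particle matrix of a layer of `F_0` gates on the pairs of modes in `l`. -/
noncomputable def hadamardLayer (l : List (Fin N × Fin N)) : Matrix (Fin N) (Fin N) ℂ :=
  (l.map fun e => hadamard e.1 e.2).reverse.prod

lemma hadamardLayer_cons (e : Fin N × Fin N) (l : List (Fin N × Fin N)) :
    hadamardLayer (e :: l) = hadamardLayer l * hadamard e.1 e.2 := by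
  simp [hadamardLayer]

lemma hadamardLayer_mem_unitaryGroup {l : List (Fin N × Fin N)} (h : ∀ e ∈ l, e.1 ≠ e.2) :
    hadamardLayer l ∈ Matrix.unitaryGroup (Fin N) ℂ := by
  refine list_prod_mem ?_
  intro x hx
  simp only [List.mem_reverse, List.mem_map] at hx
  obtain ⟨e, he, rfl⟩ := hx
  exact hadamard_mem_unitaryGroup (h e he)

/-- The pairs in the list `l` are pairs of distinct modes, and no mode is in two of them. -/
def IsMatching (l : List (Fin N × Fin N)) : Prop :=
  (∀ e ∈ l, e.1 ≠ e.2) ∧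
    l.Pairwise fun e e' => Disjoint ({e.1, e.2} : Finset (Fin N)) {e'.1, e'.2}

lemma hadamardLayer_mul_of_forall_ne {l : List (Fin N × Fin N)} {r : Fin N}
    (h : ∀ e ∈ l, r ≠ e.1 ∧ r ≠ e.2) (A : Matrix (Fin N) (Fin N) ℂ) :
    (hadamardLayer l * A) r = A r := by
  induction l generalizing A with
  | nil => simp [hadamardLayer]
  | cons e l ih =>
    have he := h e List.mem_cons_self
    rw [hadamardLayer_cons, mul_assoc, ih fun e he => h e (List.mem_cons_of_mem _ he),
      hadamard_mul_of_ne he.1 he.2]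

lemma hadamardLayer_mul_of_mem {l : List (Fin N × Fin N)} (h : IsMatching l) {e : Fin N × Fin N}
    (he : e ∈ l) (A : Matrix (Fin N) (Fin N) ℂ) :
    (hadamardLayer l * A) e.1 = ((Real.sqrt 2 : ℝ) : ℂ)⁻¹ • (A e.1 + A e.2) ∧
      (hadamardLayer l * A) e.2 = ((Real.sqrt 2 : ℝ) : ℂ)⁻¹ • (A e.1 - A e.2) := by
  induction l generalizing A with
  | nil => simp at he
  | cons a l ih =>
    obtain ⟨h1, h2⟩ := h
    rw [List.pairwise_cons] at h2
    have hne : ∀ e' ∈ l, (e'.1 ≠ a.1 ∧ e'.1 ≠ a.2) ∧ (e'.2 ≠ a.1 ∧ e'.2 ≠ a.2) := by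
      intro e' he'
      have := h2.1 e' he'
      simp only [Finset.disjoint_insert_left, Finset.disjoint_singleton_left, Finset.mem_insert,
        Finset.mem_singleton, not_or] at this
      exact ⟨⟨Ne.symm this.1.1, Ne.symm this.2.1⟩, ⟨Ne.symm this.1.2, Ne.symm this.2.2⟩⟩
    rw [hadamardLayer_cons, mul_assoc]
    rcases List.mem_cons.1 he with rfl | he
    · rw [hadamardLayer_mul_of_forall_ne fun e' he' =>
          ⟨(hne e' he').1.1.symm, (hne e' he').2.1.symm⟩,
        hadamardLayer_mul_of_forall_ne fun e' he' =>
          ⟨(hne e' he').1.2.symm, (hne e' he').2.2.symm⟩]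
      exact ⟨hadamard_mul_fst _ _ _, hadamard_mul_snd (h1 e List.mem_cons_self) _⟩
    · have := ih ⟨fun e he => h1 e (List.mem_cons_of_mem _ he), h2.2⟩ he (hadamard a.1 a.2 * A)
      rwa [hadamard_mul_of_ne (hne e he).1.1 (hne e he).1.2,
        hadamard_mul_of_ne (hne e he).2.1 (hne e he).2.2] at this

lemma hadamardLayer_mul_self {l : List (Fin N × Fin N)} (h : IsMatching l) :
    hadamardLayer l * hadamardLayer l = 1 := by
  rw [← mul_one (hadamardLayer l * hadamardLayer l), mul_assoc]
  refine funext fun r => ?_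
  by_cases hr : ∀ e ∈ l, r ≠ e.1 ∧ r ≠ e.2
  · rw [hadamardLayer_mul_of_forall_ne hr, hadamardLayer_mul_of_forall_ne hr]
  · push Not at hr
    obtain ⟨e, he, hr⟩ := hr
    obtain ⟨a1, a2⟩ := hadamardLayer_mul_of_mem h he (hadamardLayer l * 1)
    obtain ⟨b1, b2⟩ := hadamardLayer_mul_of_mem h he 1
    by_cases h1 : r = e.1
    · rw [h1, a1, b1, b2, ← smul_add, smul_smul, inv_sqrt_two_mul_self]
      module
    · rw [hr h1, a2, b1, b2, ← smul_sub, smul_smul, inv_sqrt_two_mul_self]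
      module

/-- The single-particle matrix of a layer of phase gates with angles `θ`. -/
noncomputable def phaseLayer (θ : Fin N → ℝ) : Matrix (Fin N) (Fin N) ℂ :=
  Matrix.diagonal fun r => Complex.exp (Complex.I * (θ r : ℂ))

lemma phaseLayer_mul_apply (θ : Fin N → ℝ) (A : Matrix (Fin N) (Fin N) ℂ) (r : Fin N) :
    (phaseLayer θ * A) r = Complex.exp (Complex.I * (θ r : ℂ)) • A r := by
  funext c
  simp [phaseLayer, Matrix.diagonal_mul]

lemma phaseLayer_mul_phaseLayer_neg (θ : Fin N → ℝ) : phaseLayer θ * phaseLayer (-θ) = 1 := by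
  rw [phaseLayer, phaseLayer, Matrix.diagonal_mul_diagonal, ← Matrix.diagonal_one]
  congr 1
  funext r
  rw [← Complex.exp_add]
  simp

lemma phaseLayer_mem_unitaryGroup (θ : Fin N → ℝ) :
    phaseLayer θ ∈ Matrix.unitaryGroup (Fin N) ℂ := by
  have hs : star (phaseLayer θ) = phaseLayer (-θ) := by
    rw [Matrix.star_eq_conjTranspose, phaseLayer, Matrix.diagonal_conjTranspose, phaseLayer]
    congr 1
    funext r
    simp [← Complex.exp_conj]
  rw [Matrix.mem_unitaryGroup_iff, hs, phaseLayer_mul_phaseLayer_neg]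

variable {Q : Type} [Fintype Q] [DecidableEq Q] {G : SimpleGraph Q} {π : Fin N ≃ Q}

lemma realizable_phaseLayer (θ : Fin N → ℝ) : Realizable G π 1 (phaseLayer θ) := by
  have hprod : ∀ l : List (Fin N), l.Nodup →
      (l.map fun s => Matrix.diagonal
        (Function.update (1 : Fin N → ℂ) s (Complex.exp (Complex.I * θ s)))).reverse.prod =
      Matrix.diagonal fun r => if r ∈ l then Complex.exp (Complex.I * θ r) else 1 := by
    intro l
    induction l with
    | nil => simp
    | cons a l ih =>
      intro hl
      rw [List.nodup_cons] at hl
      simp only [List.map_cons, List.reverse_cons, List.prod_append, List.prod_singleton]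
      rw [ih hl.2, Matrix.diagonal_mul_diagonal]
      congr 1
      funext r
      by_cases hr : r = a
      · subst hr
        simp [hl.1]
      · simp [hr]
  have h := realizable_layer (G := G) (π := π) (List.finRange N) (fun s => Gate.phase (θ s) s) _
    (fun s _ => ⟨?_, trivial, ?_⟩) (fun s _ => implements_phaseGate π (θ s) s) ?_
  · rw [hprod _ (List.nodup_finRange N)] at h
    simpa [phaseLayer] using h
  · intro p hp q hq hpq
    simp only [Gate.modes, Finset.mem_singleton] at hp hq
    exact absurd (hp.trans hq.symm) hpq
  · exact actsOnlyOn_phaseGate π (θ s) (by simp [Gate.modes])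
  · refine (List.nodup_finRange N).imp fun {a b} hab => ?_
    simpa [Gate.modes] using hab

lemma realizable_hadamardLayer (hG : IsHamiltonianPath G π) {l : List (Fin N × Fin N)}
    (h : IsMatching l) (hl : ∀ e ∈ l, (e.1 : ℕ) + 1 = e.2) :
    Realizable G π 1 (hadamardLayer l) := by
  refine realizable_layer l (fun e => Gate.F0 e.1 e.2) _ (fun e he => ⟨?_, h.1 e he, ?_⟩)
    (fun e he => implements_F0 π (h.1 e he)) h.2
  · have hadj := hG _ _ (hl e he)
    intro p hp q hq hpq
    simp only [Gate.modes, Finset.mem_insert, Finset.mem_singleton] at hp hq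
    rcases hp with rfl | rfl <;> rcases hq with rfl | rfl
    exacts [absurd rfl hpq, hadj, hadj.symm, absurd rfl hpq]
  · exact actsOnlyOn_F0 π (hl e he) (by simp [Gate.modes]) (by simp [Gate.modes])

end Layers

/-! ### Triangularization by layers of Givens rotations -/

section Givens

/-- Phases for which the interferometer `H · diag(1, e^{-iφ}) · H · diag(1, e^{-iψ})` maps the
vector `(a, b)` to a multiple of the first basis vector. -/
lemma exists_interferometer_angles (a b : ℂ) : ∃ ψ φ : ℝ,
    (1 - Complex.exp (Complex.I * ((-φ : ℝ) : ℂ))) * a +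
      (1 + Complex.exp (Complex.I * ((-φ : ℝ) : ℂ))) *
        (Complex.exp (Complex.I * ((-ψ : ℝ) : ℂ)) * b) = 0 := by
  -- For `u = arg a` and `e^{-iψ} b = -i |b| e^{iu}` the condition is `tan (φ / 2) = |b| / |a|`.
  set z : ℂ := ⟨‖a‖, ‖b‖⟩ with hz
  set α := z.arg
  obtain ⟨u, ha⟩ : ∃ u : ℝ, a = ‖a‖ * Complex.exp (u * Complex.I) :=
    ⟨a.arg, (Complex.norm_mul_exp_arg_mul_I a).symm⟩
  obtain ⟨v, hb⟩ : ∃ v : ℝ, b = ‖b‖ * Complex.exp (v * Complex.I) :=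
    ⟨b.arg, (Complex.norm_mul_exp_arg_mul_I b).symm⟩
  refine ⟨v - u + Real.pi / 2, 2 * α, ?_⟩
  have h1 : (‖a‖ : ℂ) = ‖z‖ * Complex.cos α := by
    have : ‖a‖ = ‖z‖ * Real.cos α := (Complex.norm_mul_cos_arg z).symm
    rw [this]; push_cast; rfl
  have h2 : (‖b‖ : ℂ) = ‖z‖ * Complex.sin α := by
    have : ‖b‖ = ‖z‖ * Real.sin α := (Complex.norm_mul_sin_arg z).symm
    rw [this]; push_cast; rfl
  have hb' : Complex.exp (Complex.I * ((-(v - u + Real.pi / 2) : ℝ) : ℂ)) * b =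
      ‖b‖ * (-Complex.I * Complex.exp (u * Complex.I)) := by
    conv_lhs => rw [hb]
    rw [mul_left_comm, ← Complex.exp_add, ← Complex.exp_neg_pi_div_two_mul_I, ← Complex.exp_add]
    congr 2
    push_cast
    ring
  have he : Complex.exp (Complex.I * ((-(2 * α) : ℝ) : ℂ)) =
      (Complex.cos α - Complex.I * Complex.sin α) ^ 2 := by
    rw [show Complex.I * ((-(2 * α) : ℝ) : ℂ) = (2 : ℕ) * (((-α : ℝ) : ℂ) * Complex.I) by
      push_cast; ring, Complex.exp_nat_mul, Complex.exp_mul_I]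
    push_cast
    rw [Complex.cos_neg, Complex.sin_neg]
    ring
  rw [hb', he]
  conv_lhs => rw [ha]
  rw [h1, h2]
  have hcs := Complex.cos_sq_add_sin_sq α
  have hI := Complex.I_sq
  generalize Complex.cos α = c at *
  generalize Complex.sin α = s at *
  have e1 : 1 - (c - Complex.I * s) ^ 2 = 2 * s * (s + Complex.I * c) := by
    linear_combination -hcs - s ^ 2 * hI
  have e2 : 1 + (c - Complex.I * s) ^ 2 = 2 * c * (c - Complex.I * s) := by
    linear_combination -hcs + s ^ 2 * hI
  rw [e1, e2]
  linear_combination (2 * s * c * ‖z‖ * Complex.exp (u * Complex.I) * s) * hI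

variable {N : ℕ} {Q : Type} [Fintype Q] [DecidableEq Q] {G : SimpleGraph Q} {π : Fin N ≃ Q}

/-- Four layers of gates carry out a rotation on each of a set of disjoint pairs of adjacent rows of
`W`, and in each pair the second row gets a zero in a prescribed column. -/
lemma exists_rotation_layer (hG : IsHamiltonianPath G π) {l : List (Fin N × Fin N)}
    (hm : IsMatching l) (hl : ∀ e ∈ l, (e.1 : ℕ) + 1 = e.2) (col : Fin N → Fin N)
    (W : Matrix (Fin N) (Fin N) ℂ) :
    ∃ L W' : Matrix (Fin N) (Fin N) ℂ, L ∈ Matrix.unitaryGroup (Fin N) ℂ ∧ Realizable G π 4 L ∧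
      W = L * W' ∧ (∀ e ∈ l, W' e.2 (col e.2) = 0) ∧
      (∀ e ∈ l, ∀ c, W e.1 c = 0 → W e.2 c = 0 → W' e.1 c = 0 ∧ W' e.2 c = 0) ∧
      ∀ r, (∀ e ∈ l, r ≠ e.1 ∧ r ≠ e.2) → W' r = W r := by
  -- Phases are applied only to the second mode of each pair.
  have hang : ∀ r : Fin N, ∃ θ : ℝ × ℝ,
      (∀ e ∈ l, e.2 = r →
        (1 - Complex.exp (Complex.I * ((-θ.2 : ℝ) : ℂ))) * W e.1 (col e.2) +
          (1 + Complex.exp (Complex.I * ((-θ.2 : ℝ) : ℂ))) *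
            (Complex.exp (Complex.I * ((-θ.1 : ℝ) : ℂ)) * W e.2 (col e.2)) = 0) ∧
      ((∀ e ∈ l, r ≠ e.2) → θ = 0) := by
    intro r
    by_cases h : ∃ e ∈ l, e.2 = r
    · obtain ⟨e, he, rfl⟩ := h
      obtain ⟨ψ, φ, h⟩ := exists_interferometer_angles (W e.1 (col e.2)) (W e.2 (col e.2))
      refine ⟨(ψ, φ), fun e' he' hee => ?_, fun h' => absurd rfl (h' e he)⟩
      have h1 := hl e he
      have h2 := hl e' he'
      have : e'.1 = e.1 := by
        rw [hee] at h2
        apply Fin.ext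
        omega
      rw [hee, this]
      exact h
    · push Not at h
      exact ⟨0, fun e he hr => absurd hr (h e he), fun _ => rfl⟩
  choose θ hθ hθ0 using hang
  set ψ : Fin N → ℝ := fun r => (θ r).1 with hψ
  set φ : Fin N → ℝ := fun r => (θ r).2 with hφ
  set H := hadamardLayer l with hH
  have hHH : H * H = 1 := hadamardLayer_mul_self hm
  have hHu : H ∈ Matrix.unitaryGroup (Fin N) ℂ := hadamardLayer_mem_unitaryGroup hm.1
  have hHr : Realizable G π 1 H := realizable_hadamardLayer hG hm hl
  have hzero : ∀ r, (∀ e ∈ l, r ≠ e.2) → ψ r = 0 ∧ φ r = 0 := by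
    intro r hr
    simp [hψ, hφ, hθ0 r hr]
  have hfst : ∀ e ∈ l, ∀ e' ∈ l, e.1 ≠ e'.2 := by
    intro e he e' he' h
    by_cases hee : e = e'
    · subst hee
      exact hm.1 e he h
    · have hs : Std.Symm fun e e' : Fin N × Fin N =>
          Disjoint ({e.1, e.2} : Finset (Fin N)) {e'.1, e'.2} := ⟨fun _ _ h => h.symm⟩
      have := hm.2.forall he he' hee
      simp only [Finset.disjoint_insert_left, Finset.disjoint_singleton_left, Finset.mem_insert,
        Finset.mem_singleton, not_or] at this
      exact this.1.2 h
  refine ⟨phaseLayer ψ * H * (phaseLayer φ * H),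
    H * (phaseLayer (-φ) * (H * (phaseLayer (-ψ) * W))), ?_, ?_, ?_, ?_⟩
  · exact mul_mem (mul_mem (phaseLayer_mem_unitaryGroup _) hHu)
      (mul_mem (phaseLayer_mem_unitaryGroup _) hHu)
  · exact ((realizable_phaseLayer ψ).mul hHr).mul ((realizable_phaseLayer φ).mul hHr)
  · have e1 : ∀ A, H * (H * A) = A := fun A => by rw [← mul_assoc, hHH, one_mul]
    have e2 : ∀ (θ : Fin N → ℝ) A, phaseLayer θ * (phaseLayer (-θ) * A) = A := fun θ A => by
      rw [← mul_assoc, phaseLayer_mul_phaseLayer_neg, one_mul]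
    simp only [mul_assoc, e1, e2]
  have hpair : ∀ e ∈ l,
      (H * (phaseLayer (-φ) * (H * (phaseLayer (-ψ) * W)))) e.1 =
        (2⁻¹ : ℂ) • ((1 + Complex.exp (Complex.I * ((-φ e.2 : ℝ) : ℂ))) • W e.1 +
          ((1 - Complex.exp (Complex.I * ((-φ e.2 : ℝ) : ℂ))) *
            Complex.exp (Complex.I * ((-ψ e.2 : ℝ) : ℂ))) • W e.2) ∧
      (H * (phaseLayer (-φ) * (H * (phaseLayer (-ψ) * W)))) e.2 =
        (2⁻¹ : ℂ) • ((1 - Complex.exp (Complex.I * ((-φ e.2 : ℝ) : ℂ))) • W e.1 +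
          ((1 + Complex.exp (Complex.I * ((-φ e.2 : ℝ) : ℂ))) *
            Complex.exp (Complex.I * ((-ψ e.2 : ℝ) : ℂ))) • W e.2) := by
    intro e he
    obtain ⟨a1, a2⟩ := hadamardLayer_mul_of_mem hm he
      (phaseLayer (-φ) * (H * (phaseLayer (-ψ) * W)))
    obtain ⟨b1, b2⟩ := hadamardLayer_mul_of_mem hm he (phaseLayer (-ψ) * W)
    obtain ⟨z1, z2⟩ := hzero e.1 (hfst e he)
    rw [hH, a1, a2]
    simp only [phaseLayer_mul_apply, b1, b2, Pi.neg_apply, z1, z2, neg_zero, Complex.ofReal_zero,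
      mul_zero, Complex.exp_zero, one_smul, hH]
    rw [← inv_sqrt_two_mul_self]
    constructor <;> module
  refine ⟨fun e he => ?_, fun e he c h1 h2 => ?_, fun r hr => ?_⟩
  · rw [(hpair e he).2]
    have := hθ e.2 e he rfl
    simp only [Pi.smul_apply, Pi.add_apply, smul_eq_mul, mul_assoc]
    rw [this, mul_zero]
  · rw [(hpair e he).1, (hpair e he).2]
    simp [h1, h2]
  · obtain ⟨z1, z2⟩ := hzero r fun e he => (hr e he).2
    rw [hH, hadamardLayer_mul_of_forall_ne hr, phaseLayer_mul_apply,
      hadamardLayer_mul_of_forall_ne hr, phaseLayer_mul_apply]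
    simp [z1, z2]

lemma exists_eq_phaseLayer {W : Matrix (Fin N) (Fin N) ℂ} (hW : W ∈ Matrix.unitaryGroup (Fin N) ℂ)
    (h : ∀ i j, j < i → W i j = 0) : ∃ θ, W = phaseLayer θ := by
  have htri : W.BlockTriangular id := fun i j hij => h i j hij
  have h1 : W * star W = 1 := Matrix.mem_unitaryGroup_iff.1 hW
  have : Invertible W := invertibleOfRightInverse _ _ h1
  have hinv : W⁻¹ = star W := Matrix.inv_eq_right_inv h1
  have htri' := Matrix.blockTriangular_inv_of_blockTriangular htri
  rw [hinv] at htri'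
  -- `star W` is the inverse of `W`, hence triangular as well.
  have hoff : ∀ i j, i ≠ j → W i j = 0 := by
    intro i j hij
    rcases lt_or_gt_of_ne hij with hlt | hlt
    · have := htri' (i := j) (j := i) hlt
      rwa [Matrix.star_apply, star_eq_zero] at this
    · exact h i j hlt
  refine ⟨fun r => (W r r).arg, ?_⟩
  ext i j
  rw [phaseLayer, Matrix.diagonal_apply]
  split_ifs with hij
  · subst hij
    have h2 := congrFun (congrFun h1 i) i
    rw [Matrix.mul_apply, Finset.sum_eq_single i (fun j _ hj => by rw [hoff i j hj.symm, zero_mul])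
      (by simp), Matrix.star_apply, Matrix.one_apply_eq] at h2
    have h3 : ‖W i i‖ = 1 := by
      have := congrArg norm h2
      rw [norm_mul, norm_star, norm_one] at this
      nlinarith [norm_nonneg (W i i)]
    rw [mul_comm]
    conv_lhs => rw [← Complex.norm_mul_exp_arg_mul_I (W i i), h3]
    simp
  · exact hoff i j hij

/-- The pairs of adjacent rows that are rotated at time `t`. The entry `(i, j)` below the diagonal is
eliminated at time `(N - 1 - i) + 2 j` by a rotation of the rows `i - 1` and `i`, so that entries
eliminated at the same time belong to disjoint pairs of rows. -/
noncomputable def rotationPairs (N t : ℕ) : List (Fin N × Fin N) :=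
  (Finset.univ.filter fun e : Fin N × Fin N =>
    (e.1 : ℕ) + 1 = e.2 ∧ ∃ j ≤ (e.1 : ℕ), (e.1 : ℕ) + t + 2 = N + 2 * j).toList

lemma mem_rotationPairs {t : ℕ} {e : Fin N × Fin N} : e ∈ rotationPairs N t ↔
    (e.1 : ℕ) + 1 = e.2 ∧ ∃ j ≤ (e.1 : ℕ), (e.1 : ℕ) + t + 2 = N + 2 * j := by
  simp [rotationPairs]

lemma isMatching_rotationPairs (t : ℕ) : IsMatching (rotationPairs N t) := by
  constructor
  · intro e he h
    have := (mem_rotationPairs.1 he).1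
    rw [h] at this
    omega
  · refine List.Nodup.pairwise_of_forall_ne (Finset.nodup_toList _) ?_
    intro e he e' he' hne
    obtain ⟨h1, j, -, h2⟩ := mem_rotationPairs.1 he
    obtain ⟨h1', j', -, h2'⟩ := mem_rotationPairs.1 he'
    have hne' : (e.1 : ℕ) ≠ e'.1 := by
      intro h
      refine hne (Prod.ext (Fin.ext h) (Fin.ext ?_))
      omega
    simp only [Finset.disjoint_insert_left, Finset.disjoint_singleton_left, Finset.mem_insert,
      Finset.mem_singleton, not_or, Fin.ext_iff]
    omega

/-- One time step of the elimination: all entries scheduled up to time `t` are zero afterwards. -/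
lemma exists_elimination_step (hG : IsHamiltonianPath G π) (t : ℕ)
    {W : Matrix (Fin N) (Fin N) ℂ} (hW : W ∈ Matrix.unitaryGroup (Fin N) ℂ)
    (h : ∀ i j : Fin N, j < i → N + 2 * (j : ℕ) < t + i + 1 → W i j = 0) :
    ∃ L W' : Matrix (Fin N) (Fin N) ℂ, Realizable G π 4 L ∧ W = L * W' ∧
      W' ∈ Matrix.unitaryGroup (Fin N) ℂ ∧
      ∀ i j : Fin N, j < i → N + 2 * (j : ℕ) < t + 1 + i + 1 → W' i j = 0 := by
  obtain ⟨L, W', hL, hR, hWL, hcol, hpair, hrest⟩ := exists_rotation_layer hG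
    (isMatching_rotationPairs t) (fun e he => (mem_rotationPairs.1 he).1)
    (fun r => ⟨(r + t + 1 - N) / 2 % N, Nat.mod_lt _ r.pos⟩) W
  refine ⟨L, W', hR, hWL, ?_, fun i j hji hij => ?_⟩
  · have : W' = star L * W := by
      rw [hWL, ← mul_assoc, Matrix.mem_unitaryGroup_iff'.1 hL, one_mul]
    rw [this]
    exact mul_mem (Unitary.star_mem hL) hW
  rw [Fin.lt_def] at hji
  by_cases hi : ∀ e ∈ rotationPairs N t, i ≠ e.1 ∧ i ≠ e.2
  · rw [hrest i hi]
    refine h i j hji ?_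
    -- Otherwise `(i, j)` would be scheduled for time `t`, and `i` would be in a rotated pair.
    by_contra hlt
    have hi0 : (i : ℕ) - 1 < N := by omega
    refine (hi (⟨i - 1, hi0⟩, i) (mem_rotationPairs.2 ⟨?_, j, ?_, ?_⟩)).2 rfl <;>
      simp only <;> omega
  · push Not at hi
    obtain ⟨e, he, hie⟩ := hi
    obtain ⟨h1, j₀, hj₀, h2⟩ := mem_rotationPairs.1 he
    by_cases hi1 : i = e.1
    · have hi1' : (i : ℕ) = e.1 := congrArg Fin.val hi1
      have := hpair e he j (h _ _ (by rw [Fin.lt_def]; omega) (by omega))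
        (h _ _ (by rw [Fin.lt_def]; omega) (by omega))
      rw [hi1]
      exact this.1
    · have hi2 := hie hi1
      have hi2' : (i : ℕ) = e.2 := congrArg Fin.val hi2
      rcases eq_or_ne (j : ℕ) j₀ with hj | hj
      · have := hcol e he
        have hc : (⟨(e.2 + t + 1 - N) / 2 % N, Nat.mod_lt _ e.2.pos⟩ : Fin N) = j := by
          apply Fin.ext
          simp only
          rw [show ((e.2 : ℕ) + t + 1 - N) / 2 = j by omega, Nat.mod_eq_of_lt j.2]
        rw [hc] at this
        rw [hi2]
        exact this
      · have := hpair e he j (h _ _ (by rw [Fin.lt_def]; omega) (by omega))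
          (h _ _ (by rw [Fin.lt_def]; omega) (by omega))
        rw [hi2]
        exact this.2

/-- Every unitary transformation of the modes is realized by a circuit of linear depth. -/
theorem realizable_of_mem_unitaryGroup (hG : IsHamiltonianPath G π)
    {W : Matrix (Fin N) (Fin N) ℂ} (hW : W ∈ Matrix.unitaryGroup (Fin N) ℂ) :
    Realizable G π (8 * N + 1) W := by
  -- At time `2 N` every entry below the diagonal has been eliminated.
  have key : ∀ m t : ℕ, t + m = 2 * N → ∀ W ∈ Matrix.unitaryGroup (Fin N) ℂ,
      (∀ i j : Fin N, j < i → N + 2 * (j : ℕ) < t + i + 1 → W i j = 0) →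
      Realizable G π (4 * m + 1) W := by
    intro m
    induction m with
    | zero =>
      intro t ht W hW h
      obtain ⟨θ, rfl⟩ := exists_eq_phaseLayer hW fun i j hij =>
        h i j hij (by rw [Fin.lt_def] at hij; omega)
      exact realizable_phaseLayer θ
    | succ m ih =>
      intro t ht W hW h
      obtain ⟨L, W', hL, rfl, hW', h'⟩ := exists_elimination_step hG t hW h
      have := hL.mul (ih (t + 1) (by omega) W' hW' h')
      rwa [show 4 + (4 * m + 1) = 4 * (m + 1) + 1 by ring] at this
  have := key (2 * N) 0 (by omega) W hW (fun i j _ h => by omega)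
  rwa [show 4 * (2 * N) + 1 = 8 * N + 1 by ring] at this

end Givens

/-! ### The snake through a rectangular lattice -/

/-- The boustrophedon order of the `R × C` lattice: the rows from top to bottom, those of even index
from left to right and those of odd index from right to left. -/
def snake (R C : ℕ) : Fin (R * C) ≃ Fin R × Fin C :=
  finProdFinEquiv.symm.trans
    (Equiv.prodShear (Equiv.refl _) fun r => if Even (r : ℕ) then Equiv.refl _ else Fin.revPerm)

lemma snake_fst (R C : ℕ) (i : Fin (R * C)) : ((snake R C i).1 : ℕ) = (i : ℕ) / C := rfl

lemma snake_snd (R C : ℕ) (i : Fin (R * C)) : ((snake R C i).2 : ℕ) =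
    if Even ((i : ℕ) / C) then (i : ℕ) % C else C - 1 - (i : ℕ) % C := by
  have h : (snake R C i).2 =
      (if Even ((i : ℕ) / C) then Equiv.refl _ else Fin.revPerm : Fin C ≃ Fin C) i.modNat := rfl
  rw [h]
  split_ifs
  · rfl
  · simp only [Fin.revPerm_apply, Fin.val_rev, Fin.coe_modNat]
    omega

lemma isHamiltonianPath_snake (R C : ℕ) : IsHamiltonianPath (lattice R C) (snake R C) := by
  intro i j hij
  have hC : 0 < C := Nat.pos_of_ne_zero fun h => by
    have := i.2
    simp [h] at this
  have hi := Nat.mod_add_div (i : ℕ) C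
  have hmi := Nat.mod_lt (i : ℕ) hC
  rw [SimpleGraph.boxProd_adj, SimpleGraph.pathGraph_adj, SimpleGraph.pathGraph_adj, Fin.ext_iff,
    Fin.ext_iff, snake_fst, snake_fst, snake_snd, snake_snd]
  by_cases hlast : (i : ℕ) % C + 1 = C
  · -- The path steps down to the next row, where the direction is reversed.
    have hj : (j : ℕ) = C * ((i : ℕ) / C + 1) := by
      rw [mul_add]
      omega
    have hd : (j : ℕ) / C = (i : ℕ) / C + 1 := by rw [hj, Nat.mul_div_cancel_left _ hC]
    have hm : (j : ℕ) % C = 0 := by rw [hj, Nat.mul_mod_right]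
    refine Or.inl ⟨Or.inl hd.symm, ?_⟩
    by_cases he : Even ((i : ℕ) / C)
    · have ho : ¬ Even ((i : ℕ) / C + 1) := by simpa [Nat.even_add_one] using he
      rw [hd, hm, if_pos he, if_neg ho]
      omega
    · have ho : Even ((i : ℕ) / C + 1) := by simpa [Nat.even_add_one] using he
      rw [hd, hm, if_neg he, if_pos ho]
      omega
  · have hj : (j : ℕ) = ((i : ℕ) % C + 1) + C * ((i : ℕ) / C) := by omega
    have hd : (j : ℕ) / C = (i : ℕ) / C := by
      rw [hj, Nat.add_mul_div_left _ _ hC, Nat.div_eq_of_lt (by omega), zero_add]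
    have hm : (j : ℕ) % C = (i : ℕ) % C + 1 := by
      rw [hj, Nat.add_mul_mod_self_left, Nat.mod_eq_of_lt (by omega)]
    refine Or.inr ⟨?_, hd.symm⟩
    rw [hd, hm]
    split_ifs <;> omega

lemma exists_isHamiltonianPath {R C n : ℕ} (h : R * C = n) :
    ∃ π : Fin n ≃ Fin R × Fin C, IsHamiltonianPath (lattice R C) π := by
  subst h
  exact ⟨snake R C, isHamiltonianPath_snake R C⟩

/-! ### The discrete Fourier transform -/

section Fourier

variable {M : ℕ}

/-- The matrix of the three-dimensional discrete Fourier transform. -/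
noncomputable def dft (ν p : Fin 3 → Fin M) : ℂ :=
  ((Real.sqrt ((M : ℝ) ^ 3) : ℝ) : ℂ)⁻¹ * Complex.exp (-Complex.I * (phase ν p : ℂ))

lemma sum_exp_eq (hM : 0 < M) (a b : Fin M) :
    ∑ x : Fin M,
      Complex.exp (2 * Real.pi * Complex.I * (((b : ℕ) : ℂ) - ((a : ℕ) : ℂ)) / M) ^ (x : ℕ) =
        if a = b then (M : ℂ) else 0 := by
  have hM0 : (M : ℂ) ≠ 0 := by exact_mod_cast hM.ne'
  split_ifs with h
  · subst h
    simp
  · rw [Fin.sum_univ_eq_sum_range (fun x => Complex.exp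
      (2 * Real.pi * Complex.I * (((b : ℕ) : ℂ) - ((a : ℕ) : ℂ)) / M) ^ x) M]
    have hpow : Complex.exp (2 * Real.pi * Complex.I * (((b : ℕ) : ℂ) - ((a : ℕ) : ℂ)) / M) ^ M
        = 1 := by
      rw [← Complex.exp_nat_mul, Complex.exp_eq_one_iff]
      refine ⟨(b : ℤ) - a, ?_⟩
      push_cast
      field_simp
    have hne : Complex.exp (2 * Real.pi * Complex.I * (((b : ℕ) : ℂ) - ((a : ℕ) : ℂ)) / M) ≠ 1 := by
      intro he
      rw [Complex.exp_eq_one_iff] at he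
      obtain ⟨n, hn⟩ := he
      have h2 : (2 * Real.pi * Complex.I : ℂ) ≠ 0 := by simp [Real.pi_ne_zero]
      have h3 : (((b : ℕ) : ℂ) - ((a : ℕ) : ℂ)) = n * M := by
        rw [div_eq_iff hM0, mul_right_comm] at hn
        apply mul_left_cancel₀ h2
        linear_combination hn
      have h4 : ((b : ℕ) : ℤ) - ((a : ℕ) : ℤ) = n * M := by exact_mod_cast h3
      have h5 : |((b : ℕ) : ℤ) - ((a : ℕ) : ℤ)| < M := by
        rw [abs_lt]
        constructor <;> omega
      have h6 := Int.eq_zero_of_abs_lt_dvd (Dvd.intro_left n h4.symm) h5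
      exact h (Fin.ext (by omega))
    have := mul_neg_geom_sum (Complex.exp
      (2 * Real.pi * Complex.I * (((b : ℕ) : ℂ) - ((a : ℕ) : ℂ)) / M)) M
    rw [hpow, sub_self] at this
    exact (mul_eq_zero.1 this).resolve_left (sub_ne_zero.2 hne.symm)

lemma sum_dft_mul_star (hM : 0 < M) (ν μ : Fin 3 → Fin M) :
    ∑ p, dft ν p * star (dft μ p) = if ν = μ then 1 else 0 := by
  have hM0 : (M : ℂ) ≠ 0 := by exact_mod_cast hM.ne'
  have hs : ((Real.sqrt ((M : ℝ) ^ 3) : ℝ) : ℂ)⁻¹ * ((Real.sqrt ((M : ℝ) ^ 3) : ℝ) : ℂ)⁻¹ =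
      ((M : ℂ) ^ 3)⁻¹ := by
    rw [← mul_inv, ← Complex.ofReal_mul, Real.mul_self_sqrt (by positivity)]
    push_cast
    rfl
  have hterm : ∀ p : Fin 3 → Fin M, dft ν p * star (dft μ p) = ((M : ℂ) ^ 3)⁻¹ *
      ∏ i, Complex.exp (2 * Real.pi * Complex.I * (((μ i : ℕ) : ℂ) - ((ν i : ℕ) : ℂ)) / M) ^
        (p i : ℕ) := by
    intro p
    have : star (dft μ p) = ((Real.sqrt ((M : ℝ) ^ 3) : ℝ) : ℂ)⁻¹ *
        Complex.exp (Complex.I * (phase μ p : ℂ)) := by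
      simp [dft, ← Complex.exp_conj]
    rw [this, dft, mul_mul_mul_comm, hs, ← Complex.exp_add]
    simp_rw [← Complex.exp_nat_mul]
    rw [← Complex.exp_sum]
    congr 2
    simp only [phase, Fin.sum_univ_three]
    push_cast
    ring
  simp_rw [hterm]
  rw [← Finset.mul_sum, ← Fintype.piFinset_univ, ← Finset.prod_univ_sum (fun _ => Finset.univ)
    (fun i (x : Fin M) => Complex.exp
      (2 * Real.pi * Complex.I * (((μ i : ℕ) : ℂ) - ((ν i : ℕ) : ℂ)) / M) ^ (x : ℕ))]
  simp_rw [sum_exp_eq hM]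
  split_ifs with h
  · subst h
    simp [hM0]
  · obtain ⟨i, hi⟩ := Function.ne_iff.1 h
    rw [Finset.prod_eq_zero (Finset.mem_univ i) (if_neg hi), mul_zero]

/-- The matrix of the three-dimensional discrete Fourier transform in the canonical order of the
orbitals. -/
noncomputable def dftMatrix (M : ℕ) : Matrix (Fin (M ^ 3)) (Fin (M ^ 3)) ℂ :=
  Matrix.of fun i j => dft (finFunctionFinEquiv.symm i) (finFunctionFinEquiv.symm j)

lemma dftMatrix_mem_unitaryGroup (hM : 0 < M) :
    dftMatrix M ∈ Matrix.unitaryGroup (Fin (M ^ 3)) ℂ := by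
  rw [Matrix.mem_unitaryGroup_iff]
  ext i j
  rw [Matrix.mul_apply, Matrix.one_apply]
  simp only [dftMatrix, Matrix.star_apply, Matrix.of_apply]
  rw [Equiv.sum_comp finFunctionFinEquiv.symm fun p =>
    dft (finFunctionFinEquiv.symm i) p * star (dft (finFunctionFinEquiv.symm j) p),
    sum_dft_mul_star hM]
  simp

variable {Q : Type} [Fintype Q] [DecidableEq Q] {π : Fin (M ^ 3) ≃ Q}

/-- The relation for the annihilation operators is the adjoint of the one for the creation
operators. -/
lemma Implements.isFFFT3 {U : Operator Q} (h : Implements π U (dftMatrix M)) : IsFFFT3 π U := by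
  obtain ⟨hU, h⟩ := h
  have hUU : Uᴴ * U = 1 := Matrix.mem_unitaryGroup_iff'.1 hU
  have hc : ∀ ν : Fin 3 → Fin M, Uᴴ * create π (orbital ν) * U =
      ((Real.sqrt ((M : ℝ) ^ 3))⁻¹ : ℂ) •
        ∑ p : Fin 3 → Fin M,
          Complex.exp (-Complex.I * (phase ν p : ℂ)) • create π (orbital p) := by
    intro ν
    rw [(h (orbital ν)).eq, mul_assoc, hUU, mul_one, Finset.smul_sum,
      ← Equiv.sum_comp finFunctionFinEquiv]
    refine Finset.sum_congr rfl fun p _ => ?_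
    simp [dftMatrix, dft, orbital, smul_smul]
  refine ⟨hU, fun ν => ⟨hc ν, ?_⟩⟩
  have := congrArg Matrix.conjTranspose (hc ν)
  simpa [create, Matrix.conjTranspose_mul, Matrix.conjTranspose_smul, Matrix.conjTranspose_sum,
    ← Complex.exp_conj, mul_assoc] using this

end Fourier

end FFFT

/-- Three-dimensional fermionic fast Fourier transform on a planar nearest-neighbour lattice:
for `M = 2 ^ k`, `N = M ^ 3` and every rectangular lattice of `N` qubits, `O(N ^ 2)` gates from the
library and depth `O(N)` suffice. -/
theorem mainTheorem2 :
    ∃ K : ℕ, ∀ k M N : ℕ, M = 2 ^ k → N = M ^ 3 →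
      ∀ R C : ℕ, R * C = N →
        ∃ π : Fin (M ^ 3) ≃ Fin R × Fin C,
          FFFT.IsHamiltonianPath (FFFT.lattice R C) π ∧
          ∃ c : FFFT.Circuit (M ^ 3),
            c.IsExecutable (FFFT.lattice R C) π ∧
            FFFT.IsFFFT3 π (c.op π) ∧
            c.size ≤ K * N ^ 2 ∧
            c.depth ≤ K * N := by
  refine ⟨9, fun k M N hM hN R C hRC => ?_⟩
  have hM0 : 0 < M := hM ▸ pow_pos two_pos k
  subst hN
  have hN0 : 0 < M ^ 3 := pow_pos hM0 3
  obtain ⟨π, hπ⟩ := FFFT.exists_isHamiltonianPath hRC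
  obtain ⟨c, hc, hd, hi⟩ := FFFT.realizable_of_mem_unitaryGroup hπ
    (FFFT.dftMatrix_mem_unitaryGroup hM0)
  have hd' : c.depth ≤ 9 * M ^ 3 := by omega
  refine ⟨π, hπ, c, hc, hi.isFFFT3, ?_, hd'⟩
  calc c.size ≤ M ^ 3 * c.depth := hc.size_le
    _ ≤ M ^ 3 * (9 * M ^ 3) := Nat.mul_le_mul_left _ hd'
    _ = 9 * (M ^ 3) ^ 2 := by ring
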